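/- Let $k \ge 1$ be an integer. An *ordered increasing $k$-tree* of size $n$ is a graph on the $k$ root nodes $0_1,\dots,0_k$ (which all have label $0$) and the $n$ inserted nodes $1,\dots,n$ such that the root nodes form a clique, and such that for every inserted node $i$ the neighbours of $i$ with a smaller label (the *parents* of $i$) form a clique of exactly $k$ nodes (we say that $i$ is a *child* of this $k$-clique), together with a linear order on the children of each $k$-clique. A *random $k$-tree* of size $n$ is chosen uniformly at random among all ordered increasing $k$-trees of size $n$. A node $w$ is a *descendant* of a node $u$ if $w=u$ or if some parent of $w$ is a descendant of $u$. For $1 \le j \le n$ let $X_{n,j}$ be the number of descendants of node $j$ in a random $k$-tree of size $n$. For real $x$ and an integer $l$ put $\binom{x}{l} = \frac{x(x-1)\cdots(x-l+1)}{l!}$ if $l \ge 0$ and $\binom{x}{l}=0$ if $l<0$. Theorem 5. The random variable $X_{n,j}$ has the exact distribution $$\mathbb{P}\{X_{n,j} = m\} = \frac{\binom{m-1-\frac{1}{k+1}}{m-1} \binom{n-m-1+\frac{2}{k+1}}{n-m-j+1}}{\binom{n-\frac{k}{k+1}}{n-j}}, \qquad n \ge j \ge 1,\ m \ge 1.$$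 The limiting distribution behaviour of $X_{n,j}$ for $n\to\infty$, depending on the growth of $j=j(n)$, is as follows. * For fixed $j \ge 1$: $\frac{X_{n,j}}{n} \xrightarrow{(d)} X_j$, where $X_j$ has the Beta distribution $\beta\big(\frac{k}{k+1},\, j-1+\frac{2}{k+1}\big)$, whose moments are $\mathbb{E}(X_j^s) = \binom{s-\frac{1}{k+1}}{s} \Big/ \binom{s+j-\frac{k}{k+1}}{s}$ for all integers $s \ge 0$. * For $j\to\infty$ with $j = o(n)$: $\frac{j}{n}X_{n,j} \xrightarrow{(d)} X$, where $X$ has the Gamma distribution $\gamma\big(\frac{k}{k+1},1\big)$, whose moments are $\mathbb{E}(X^s) = s!\binom{s-\frac{1}{k+1}}{s}$ for all integers $s\ge 0$. * For $j \sim \rho n$ with a constant $0<\rho<1$: $X_{n,j}-1 \xrightarrow{(d)} X_\rho$, where $X_\rho$ has the negative binomial distribution $\mathrm{NegBin}\big(\frac{k}{k+1},\rho\big)$, i.e. $\mathbb{P}\{X_\rho = m\} = \binom{m-\frac{1}{k+1}}{m}\rho^{\frac{k}{k+1}}(1-\rho)^m$ for all integers $m \ge 0$. * For $j \le n$ with $n-j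 = o(n)$: $\mathbb{P}\{X_{n,j}=1\} \to 1$. -/

import Mathlib

open MeasureTheory ProbabilityTheory Filter Asymptotics Topology

/-- The binomial coefficient `x (x - 1) ⋯ (x - l + 1) / l!` with a real upper index and an integer
lower index; it is `0` for a negative lower index. -/
noncomputable def gbinom (x : ℝ) (l : ℤ) : ℝ :=
  if 0 ≤ l then Ring.choose x l.toNat else 0

/-- The negative binomial distribution with (real) parameter `r` and success probability `p`:
the measure on `ℕ` that gives `m` the mass `binom (m + r - 1) m * p ^ r * (1 - p) ^ m`. -/
noncomputable def negBinMeasure (r p : ℝ) : Measure ℕ :=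
  Measure.sum fun m : ℕ =>
    ENNReal.ofReal (gbinom (m + r - 1) m * p ^ r * (1 - p) ^ m) • Measure.dirac m

/-- The nodes of a `k`-tree of size `n`: the `k` root nodes `0_1, …, 0_k` (left summand) and the
`n` inserted nodes (right summand). -/
abbrev KTreeNode (k n : ℕ) : Type := Fin k ⊕ Fin n

/-- The label of a node: `0` for each root node, and `i + 1` for the `i`-th element of `Fin n`, so
that the inserted nodes have the labels `1, …, n`. -/
def KTreeNode.label {k n : ℕ} : KTreeNode k n → ℕ
  | Sum.inl _ => 0
  | Sum.inr i => (i : ℕ) + 1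

/-- The neighbours of the inserted node `i` that have a smaller label. -/
def lowerNeighbours {k n : ℕ} (G : SimpleGraph (KTreeNode k n)) (i : Fin n) :
    Set (KTreeNode k n) :=
  {v | G.Adj (Sum.inr i) v ∧ v.label < KTreeNode.label (Sum.inr i : KTreeNode k n)}

/-- Ordered increasing `k`-trees of size `n`: labelled rooted `k`-trees with `n` inserted nodes,
where labels increase from parents to children and the children of each `k`-clique are linearly
ordered.

The root nodes form a clique, and every inserted node `i` is attached to a `k`-clique of nodes with
smaller labels (so that removing the node with the largest label, which has degree `k`, leaves a
`k`-tree with one inserted node less, until only the root clique remains). The linear order on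
the children of a clique is given by the position `0, 1, 2, …` of each child. -/
@[ext]
structure OrderedIncreasingKTree (k n : ℕ) where
  /-- the underlying graph -/
  graph : SimpleGraph (KTreeNode k n)
  /-- the root nodes form a clique -/
  root_clique : ∀ a b : Fin k, a ≠ b → graph.Adj (Sum.inl a) (Sum.inl b)
  /-- the parents of an inserted node are pairwise adjacent … -/
  parents_clique : ∀ i : Fin n, graph.IsClique (lowerNeighbours graph i)
  /-- … and there are exactly `k` of them -/
  parents_ncard : ∀ i : Fin n, (lowerNeighbours graph i).ncard = k
  /-- the position of `i` in the order on the children of the clique that `i` is attached to -/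
  position : Fin n → ℕ
  /-- positions are smaller than the number of children of the clique … -/
  position_lt : ∀ i : Fin n,
    position i < {i' : Fin n | lowerNeighbours graph i' = lowerNeighbours graph i}.ncard
  /-- … and different children of the same clique have different positions -/
  position_inj : ∀ i i' : Fin n, lowerNeighbours graph i = lowerNeighbours graph i' →
    position i = position i' → i = i'

namespace OrderedIncreasingKTree

variable {k n : ℕ}

/-- The parents of an inserted node: the `k`-clique to which it is attached. -/
def parents (T : OrderedIncreasingKTree k n) (i : Fin n) : Set (KTreeNode k n) :=
  lowerNeighbours T.graph i

/-- `T.IsDescendant u w`: the node `w` is a descendant of the node `u`, i.e. `w = u` or some parent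
of `w` is a descendant of `u`. -/
inductive IsDescendant (T : OrderedIncreasingKTree k n) (u : KTreeNode k n) :
    KTreeNode k n → Prop
  | refl : IsDescendant T u u
  | step (v : KTreeNode k n) (i : Fin n) (hv : v ∈ T.parents i) (h : IsDescendant T u v) :
      IsDescendant T u (Sum.inr i)

/-- The number of descendants of node `j`, that is, of the inserted node with label `j` (which is
meaningful for `1 ≤ j ≤ n`; there is no such node otherwise, and the value is `0`). -/
noncomputable def numDescendants (j : ℕ) (T : OrderedIncreasingKTree k n) : ℕ :=
  {w : KTreeNode k n |
    ∃ i : Fin n, KTreeNode.label (Sum.inr i : KTreeNode k n) = j ∧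
      T.IsDescendant (Sum.inr i) w}.ncard

theorem position_lt_size (T : OrderedIncreasingKTree k n) (i : Fin n) : T.position i < n := by
  refine (T.position_lt i).trans_le ?_
  simpa using Set.ncard_le_card {i' : Fin n | lowerNeighbours T.graph i' = lowerNeighbours T.graph i}

instance : Finite (OrderedIncreasingKTree k n) := by
  refine Finite.of_injective
    (fun T : OrderedIncreasingKTree k n =>
      ((T.graph, fun i => ⟨T.position i, T.position_lt_size i⟩) :
        SimpleGraph (KTreeNode k n) × (Fin n → Fin n))) ?_
  intro T T' h
  simp only [Prod.mk.injEq] at h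
  refine OrderedIncreasingKTree.ext h.1 ?_
  funext i
  simpa using congrFun h.2 i

/-- The graph in which all inserted nodes are attached to the root clique. -/
def starGraph (k n : ℕ) : SimpleGraph (KTreeNode k n) where
  Adj u v := u ≠ v ∧ (u.label = 0 ∨ v.label = 0)
  symm := ⟨fun _ _ h => ⟨h.1.symm, h.2.symm⟩⟩
  loopless := ⟨fun _ h => h.1 rfl⟩

theorem lowerNeighbours_starGraph (i : Fin n) :
    lowerNeighbours (starGraph k n) i = Set.range Sum.inl := by
  ext v
  rcases v with a | b <;> simp [lowerNeighbours, starGraph, KTreeNode.label]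

instance : Nonempty (OrderedIncreasingKTree k n) :=
  ⟨{ graph := starGraph k n
     root_clique := fun a b h => by simp [starGraph, KTreeNode.label, h]
     parents_clique := fun i => by
       rw [lowerNeighbours_starGraph]
       rintro _ ⟨a, rfl⟩ _ ⟨b, rfl⟩ h
       exact ⟨h, Or.inl rfl⟩
     parents_ncard := fun i => by
       rw [lowerNeighbours_starGraph, ← Set.image_univ,
         Set.ncard_image_of_injective _ Sum.inl_injective, Set.ncard_univ, Nat.card_fin]
     position := fun i => i
     position_lt := fun i => by
       simp [lowerNeighbours_starGraph, Set.ncard_univ]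
     position_inj := fun i i' _ h => Fin.ext h }⟩

/-- Every set of trees is an event. -/
instance : MeasurableSpace (OrderedIncreasingKTree k n) := ⊤

instance : MeasurableSingletonClass (OrderedIncreasingKTree k n) :=
  ⟨fun _ => MeasurableSpace.measurableSet_top⟩

end OrderedIncreasingKTree

/-- The random ordered increasing `k`-tree model: the uniform distribution on the ordered increasing
`k`-trees of size `n`. -/
noncomputable def randomKTree (k n : ℕ) : Measure (OrderedIncreasingKTree k n) :=
  uniformOn Set.univ

instance (k n : ℕ) : IsProbabilityMeasure (randomKTree k n) := by
  unfold randomKTree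
  infer_instance

/-!
The number of descendants of a node evolves like a Pólya urn. A `k`-tree of size `n` has `k n + 1`
cliques of size `k`, and a clique with `d` children offers `d + 1` places to a new node, so there
are `(k + 1) n + 1` places altogether (`sum_places`). A new node becomes a descendant of `j` exactly
if the clique it joins contains one. The largest node of such a clique is then itself a descendant,
and each node is the largest one of `k` cliques; so if `j` has `m` descendants, `k m` cliques are of
this kind, their children are the `m - 1` other descendants of `j`, and `(k + 1) m - 1` places make
the new node a descendant (`sum_places_meeting`).

Hence `X - 1`, where `X` is the number of descendants of `j`, has the beta-binomial distribution
with `n - j` trials and parameters `α = k / (k + 1)` and `β = j - 1 + 2 / (k + 1)`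
(`randomKTree_real_numDescendants`). This is the exact distribution, and it says that `X - 1` is
binomial with a beta distributed success probability `B`.

By the variance of the binomial distribution, `c X / n` is close to `c B` when tested against
Lipschitz functions, with an error of order `c / √(j n)` (`abs_integral_numDescendants_sub_le`).
With `c = 1` this is the limit for fixed `j`. With `c = j` it reduces the case `j = o(n)` to the
weak convergence of `j B` to a gamma distribution, which follows from the pointwise convergence of
the densities (`tendsto_integral_betaMeasure`). For `j ∼ ρ n` the point masses themselves converge
(`tendsto_betaBinomial`), and their limits add up to `1`; the mass at `X = 1` converges also for
`ρ = 1` (`tendsto_betaBinomial_zero`). The constants in the last two arguments come from Wendel's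
asymptotic formula `Γ (x + s) ∼ x ^ s Γ x` (`tendsto_Gamma_add_div`).
-/

/-! ### Removing and adding the node with the largest label -/

namespace KTreeNode

variable {k n : ℕ}

/-- The inclusion of the nodes of a `k`-tree of size `n` into those of a `k`-tree of size `n + 1`;
it preserves labels. -/
def emb : KTreeNode k n ↪ KTreeNode k (n + 1) :=
  ⟨Sum.map id Fin.castSucc, Function.Injective.sumMap Function.injective_id
    (Fin.castSucc_injective n)⟩

/-- The node with the largest label `n + 1`. -/
def last : KTreeNode k (n + 1) := Sum.inr (Fin.last n)

@[simp] theorem emb_inl (a : Fin k) : emb (n := n) (Sum.inl a) = Sum.inl a := rfl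

@[simp] theorem emb_inr (i : Fin n) : emb (k := k) (Sum.inr i) = Sum.inr i.castSucc := rfl

@[simp] theorem label_emb (v : KTreeNode k n) : (emb v).label = v.label := by
  rcases v with a | i <;> rfl

@[simp] theorem label_last : (last : KTreeNode k (n + 1)).label = n + 1 := rfl

theorem label_le (v : KTreeNode k n) : v.label ≤ n := by
  rcases v with a | i
  · exact Nat.zero_le _
  · exact i.2

@[simp] theorem emb_ne_last (v : KTreeNode k n) : emb v ≠ last := by
  intro h
  have h1 := congrArg KTreeNode.label h
  have h2 := v.label_le
  rw [label_emb, label_last] at h1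
  omega

@[simp] theorem last_ne_emb (v : KTreeNode k n) : last ≠ emb v := (emb_ne_last v).symm

theorem eq_emb_or_eq_last (v : KTreeNode k (n + 1)) : (∃ a, v = emb a) ∨ v = last := by
  rcases v with a | i
  · exact Or.inl ⟨Sum.inl a, rfl⟩
  · rcases Fin.eq_castSucc_or_eq_last i with ⟨i, rfl⟩ | rfl
    · exact Or.inl ⟨Sum.inr i, rfl⟩
    · exact Or.inr rfl

theorem eq_of_label_eq {v : KTreeNode k n} {i : Fin n}
    (h : v.label = KTreeNode.label (Sum.inr i : KTreeNode k n)) : v = Sum.inr i := by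
  rcases v with a | j
  · simp [label] at h
  · simp only [label, Nat.add_right_cancel_iff] at h
    rw [Fin.ext h]

end KTreeNode


section Graph

open KTreeNode
open scoped Classical

variable {k n : ℕ}

/-- The graphs that underlie ordered increasing `k`-trees. -/
structure IsIncreasingKTree (G : SimpleGraph (KTreeNode k n)) : Prop where
  root_clique : ∀ a b : Fin k, a ≠ b → G.Adj (Sum.inl a) (Sum.inl b)
  parents_clique : ∀ i : Fin n, G.IsClique (lowerNeighbours G i)
  parents_ncard : ∀ i : Fin n, (lowerNeighbours G i).ncard = k

/-- The parents of an inserted node as a `Finset`. -/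
noncomputable def parentFinset (G : SimpleGraph (KTreeNode k n)) (i : Fin n) :
    Finset (KTreeNode k n) :=
  (lowerNeighbours G i).toFinset

@[simp] theorem mem_parentFinset {G : SimpleGraph (KTreeNode k n)} {i : Fin n}
    {v : KTreeNode k n} :
    v ∈ parentFinset G i ↔
      G.Adj (Sum.inr i) v ∧ v.label < KTreeNode.label (Sum.inr i : KTreeNode k n) := by
  simp only [parentFinset, Set.mem_toFinset]
  rfl

theorem coe_parentFinset (G : SimpleGraph (KTreeNode k n)) (i : Fin n) :
    (parentFinset G i : Set (KTreeNode k n)) = lowerNeighbours G i := by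
  simp [parentFinset]

theorem IsIncreasingKTree.card_parentFinset {G : SimpleGraph (KTreeNode k n)}
    (hG : IsIncreasingKTree G) (i : Fin n) : (parentFinset G i).card = k := by
  refine Eq.trans ?_ (hG.parents_ncard i)
  rw [← coe_parentFinset, Set.ncard_coe_finset]

/-- The graph `G` with one more node, joined to the nodes in `C`. -/
def extendGraph (G : SimpleGraph (KTreeNode k n)) (C : Finset (KTreeNode k n)) :
    SimpleGraph (KTreeNode k (n + 1)) where
  Adj u v := (∃ a b, emb a = u ∧ emb b = v ∧ G.Adj a b) ∨
    ∃ a ∈ C, (emb a = u ∧ v = last) ∨ (emb a = v ∧ u = last)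
  symm := ⟨by
    rintro u v (⟨a, b, ha, hb, h⟩ | ⟨a, ha, h⟩)
    · exact Or.inl ⟨b, a, hb, ha, h.symm⟩
    · exact Or.inr ⟨a, ha, h.symm⟩⟩
  loopless := ⟨by
    rintro u (⟨a, b, rfl, hb, h⟩ | ⟨a, ha, ⟨rfl, h⟩ | ⟨rfl, h⟩⟩)
    · exact h.ne (emb.injective hb).symm
    · exact emb_ne_last _ h
    · exact emb_ne_last _ h⟩

/-- The graph without the node with the largest label. -/
def removeLast (H : SimpleGraph (KTreeNode k (n + 1))) : SimpleGraph (KTreeNode k n) :=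
  H.comap emb

/-- The nodes to which the node with the largest label is joined. -/
noncomputable def attachSet (H : SimpleGraph (KTreeNode k (n + 1))) : Finset (KTreeNode k n) :=
  Finset.univ.filter fun v => H.Adj last (emb v)

@[simp] theorem extendGraph_adj_emb {G : SimpleGraph (KTreeNode k n)} {C : Finset (KTreeNode k n)}
    {a b : KTreeNode k n} : (extendGraph G C).Adj (emb a) (emb b) ↔ G.Adj a b := by
  simp [extendGraph, -Sum.exists]

@[simp] theorem extendGraph_adj_last {G : SimpleGraph (KTreeNode k n)}
    {C : Finset (KTreeNode k n)} {a : KTreeNode k n} :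
    (extendGraph G C).Adj last (emb a) ↔ a ∈ C := by
  simp [extendGraph, -Sum.exists]

@[simp] theorem removeLast_adj {H : SimpleGraph (KTreeNode k (n + 1))} {a b : KTreeNode k n} :
    (removeLast H).Adj a b ↔ H.Adj (emb a) (emb b) := Iff.rfl

@[simp] theorem mem_attachSet {H : SimpleGraph (KTreeNode k (n + 1))} {a : KTreeNode k n} :
    a ∈ attachSet H ↔ H.Adj last (emb a) := by
  simp [attachSet]

/-- Graphs on `n + 1` inserted nodes correspond to graphs on `n` inserted nodes together with the
set of neighbours of the last node. -/
noncomputable def graphEquiv : SimpleGraph (KTreeNode k (n + 1)) ≃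
    SimpleGraph (KTreeNode k n) × Finset (KTreeNode k n) where
  toFun H := (removeLast H, attachSet H)
  invFun p := extendGraph p.1 p.2
  left_inv H := by
    ext u v
    rcases u.eq_emb_or_eq_last with ⟨a, rfl⟩ | rfl <;>
      rcases v.eq_emb_or_eq_last with ⟨b, rfl⟩ | rfl
    · simp
    · rw [SimpleGraph.adj_comm, H.adj_comm]; simp
    · simp
    · simp
  right_inv p := by
    refine Prod.ext ?_ ?_
    · ext a b; simp
    · ext a; simp

@[simp] theorem removeLast_extendGraph (G : SimpleGraph (KTreeNode k n))
    (C : Finset (KTreeNode k n)) : removeLast (extendGraph G C) = G :=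
  congrArg Prod.fst (graphEquiv.right_inv (G, C))

@[simp] theorem attachSet_extendGraph (G : SimpleGraph (KTreeNode k n))
    (C : Finset (KTreeNode k n)) : attachSet (extendGraph G C) = C :=
  congrArg Prod.snd (graphEquiv.right_inv (G, C))

theorem parentFinset_castSucc (H : SimpleGraph (KTreeNode k (n + 1))) (i : Fin n) :
    parentFinset H i.castSucc = (parentFinset (removeLast H) i).map emb := by
  ext v
  rcases v.eq_emb_or_eq_last with ⟨a, rfl⟩ | rfl
  · simp [← emb_inr]
  · simp only [mem_parentFinset, ← emb_inr, label_emb, label_last, Finset.mem_map,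
      emb_ne_last, and_false, exists_false, iff_false, not_and, not_lt]
    intro _
    have := label_le (Sum.inr i : KTreeNode k n)
    omega

theorem parentFinset_last (H : SimpleGraph (KTreeNode k (n + 1))) :
    parentFinset H (Fin.last n) = (attachSet H).map emb := by
  ext v
  rcases v.eq_emb_or_eq_last with ⟨a, rfl⟩ | rfl
  · have := a.label_le
    have h : KTreeNode.label (Sum.inr (Fin.last n) : KTreeNode k (n + 1)) = n + 1 := rfl
    simp only [mem_parentFinset, h, label_emb, Finset.mem_map, mem_attachSet,
      EmbeddingLike.apply_eq_iff_eq, exists_eq_right]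
    constructor
    · exact fun h => h.1
    · exact fun h => ⟨h, by omega⟩
  · simp [last]

theorem isClique_map_emb {H : SimpleGraph (KTreeNode k (n + 1))} {C : Finset (KTreeNode k n)} :
    H.IsClique (C.map emb : Finset _) ↔ (removeLast H).IsClique C := by
  simp [SimpleGraph.IsClique, Set.Pairwise]

/-- The parents condition in terms of `parentFinset`. -/
theorem isIncreasingKTree_iff {G : SimpleGraph (KTreeNode k n)} :
    IsIncreasingKTree G ↔ (∀ a b : Fin k, a ≠ b → G.Adj (Sum.inl a) (Sum.inl b)) ∧
      ∀ i, G.IsNClique k (parentFinset G i) := by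
  constructor
  · intro h
    exact ⟨h.root_clique, fun i => ⟨by rw [coe_parentFinset]; exact h.parents_clique i,
      h.card_parentFinset i⟩⟩
  · rintro ⟨h1, h2⟩
    refine ⟨h1, fun i => ?_, fun i => ?_⟩
    · rw [← coe_parentFinset]; exact (h2 i).1
    · rw [← coe_parentFinset, Set.ncard_coe_finset]; exact (h2 i).2

theorem isNClique_map_emb {H : SimpleGraph (KTreeNode k (n + 1))} {C : Finset (KTreeNode k n)} :
    H.IsNClique k (C.map emb) ↔ (removeLast H).IsNClique k C := by
  rw [SimpleGraph.isNClique_iff, SimpleGraph.isNClique_iff, isClique_map_emb, Finset.card_map]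

/-- A `k`-tree of size `n + 1` is a `k`-tree of size `n` with one more node, attached to a
`k`-clique. -/
theorem isIncreasingKTree_succ_iff {H : SimpleGraph (KTreeNode k (n + 1))} :
    IsIncreasingKTree H ↔
      IsIncreasingKTree (removeLast H) ∧ (removeLast H).IsNClique k (attachSet H) := by
  simp only [isIncreasingKTree_iff, Fin.forall_fin_succ', parentFinset_castSucc,
    parentFinset_last, isNClique_map_emb, removeLast_adj, emb_inl, and_assoc]

/-! ### Descendants -/

/-- `v` is a parent of `w`. -/
def IsParent (G : SimpleGraph (KTreeNode k n)) (v w : KTreeNode k n) : Prop :=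
  ∃ i, w = Sum.inr i ∧ v ∈ parentFinset G i

/-- The descendants of `u`. -/
noncomputable def descFinset (G : SimpleGraph (KTreeNode k n)) (u : KTreeNode k n) :
    Finset (KTreeNode k n) :=
  Finset.univ.filter fun w => Relation.ReflTransGen (IsParent G) u w

@[simp] theorem mem_descFinset {G : SimpleGraph (KTreeNode k n)} {u w : KTreeNode k n} :
    w ∈ descFinset G u ↔ Relation.ReflTransGen (IsParent G) u w := by
  simp [descFinset]

theorem isParent_emb {H : SimpleGraph (KTreeNode k (n + 1))} {v w : KTreeNode k n} :
    IsParent H (emb v) (emb w) ↔ IsParent (removeLast H) v w := by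
  constructor
  · rintro ⟨i, hi, hv⟩
    rcases w with a | j
    · simp at hi
    · simp only [emb_inr, Sum.inr.injEq] at hi
      subst hi
      rw [parentFinset_castSucc] at hv
      exact ⟨j, rfl, by simpa using hv⟩
  · rintro ⟨i, rfl, hv⟩
    exact ⟨i.castSucc, rfl, by rw [parentFinset_castSucc]; simpa using hv⟩

theorem IsParent.label_lt {G : SimpleGraph (KTreeNode k n)} {v w : KTreeNode k n}
    (h : IsParent G v w) : v.label < w.label := by
  obtain ⟨i, rfl, hv⟩ := h
  exact (mem_parentFinset.1 hv).2

theorem isParent_last {H : SimpleGraph (KTreeNode k (n + 1))} {v : KTreeNode k n} :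
    IsParent H (emb v) last ↔ v ∈ attachSet H := by
  constructor
  · rintro ⟨i, hi, hv⟩
    have hi' : i = Fin.last n := by simpa [last] using hi.symm
    subst hi'
    rw [parentFinset_last] at hv
    simpa using hv
  · intro h
    exact ⟨Fin.last n, rfl, by rw [parentFinset_last]; simpa using h⟩

theorem not_isParent_last (H : SimpleGraph (KTreeNode k (n + 1))) (w : KTreeNode k (n + 1)) :
    ¬ IsParent H last w := by
  intro h
  have h1 := h.label_lt
  have h2 := w.label_le
  rw [label_last] at h1
  omega

theorem reflTransGen_emb {H : SimpleGraph (KTreeNode k (n + 1))} {u w : KTreeNode k n} :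
    Relation.ReflTransGen (IsParent H) (emb u) (emb w) ↔
      Relation.ReflTransGen (IsParent (removeLast H)) u w := by
  constructor
  · intro h
    generalize hx : emb w = x at h
    induction h generalizing w with
    | refl => rw [emb.injective hx]
    | @tail y z _ hyz ih =>
      subst hx
      rcases y.eq_emb_or_eq_last with ⟨a, rfl⟩ | rfl
      · exact (ih rfl).tail (isParent_emb.1 hyz)
      · exact absurd hyz (not_isParent_last _ _)
  · intro h
    exact h.lift emb fun _ _ => isParent_emb.2

theorem reflTransGen_emb_last {H : SimpleGraph (KTreeNode k (n + 1))} {u : KTreeNode k n} :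
    Relation.ReflTransGen (IsParent H) (emb u) last ↔
      ∃ v ∈ attachSet H, v ∈ descFinset (removeLast H) u := by
  constructor
  · intro h
    rcases Relation.ReflTransGen.cases_tail h with h | ⟨y, hy, hyl⟩
    · exact absurd h (by simp)
    · rcases y.eq_emb_or_eq_last with ⟨a, rfl⟩ | rfl
      · exact ⟨a, isParent_last.1 hyl, mem_descFinset.2 (reflTransGen_emb.1 hy)⟩
      · exact absurd hyl (not_isParent_last _ _)
  · rintro ⟨v, hv, hd⟩
    exact (reflTransGen_emb.2 (mem_descFinset.1 hd)).tail (isParent_last.2 hv)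

theorem descFinset_last (H : SimpleGraph (KTreeNode k (n + 1))) :
    descFinset H last = {last} := by
  ext w
  rw [mem_descFinset, Finset.mem_singleton]
  constructor
  · intro h
    rcases Relation.ReflTransGen.cases_head h with h | ⟨y, hy, _⟩
    · exact h.symm
    · exact absurd hy (not_isParent_last _ _)
  · rintro rfl
    exact .refl

/-- The new node is a descendant of `u` exactly if it is attached to a clique that contains a
descendant of `u`. -/
theorem card_descFinset_emb (H : SimpleGraph (KTreeNode k (n + 1))) (u : KTreeNode k n) :
    (descFinset H (emb u)).card = (descFinset (removeLast H) u).card +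
      if Disjoint (attachSet H) (descFinset (removeLast H) u) then 0 else 1 := by
  by_cases h : Disjoint (attachSet H) (descFinset (removeLast H) u)
  · have : descFinset H (emb u) = (descFinset (removeLast H) u).map emb := by
      ext w
      rcases w.eq_emb_or_eq_last with ⟨a, rfl⟩ | rfl
      · simp [reflTransGen_emb]
      · simp only [mem_descFinset, reflTransGen_emb_last, Finset.mem_map, emb_ne_last,
          and_false, exists_false, iff_false]
        rintro ⟨v, hv, hd⟩
        exact Finset.disjoint_left.1 h hv (mem_descFinset.2 hd)
    rw [this, Finset.card_map, if_pos h, add_zero]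
  · have : descFinset H (emb u) = insert last ((descFinset (removeLast H) u).map emb) := by
      ext w
      rcases w.eq_emb_or_eq_last with ⟨a, rfl⟩ | rfl
      · simp [reflTransGen_emb]
      · simpa [reflTransGen_emb_last, -Sum.exists] using Finset.not_disjoint_iff.1 h
    rw [this, Finset.card_insert_of_notMem (by simp), Finset.card_map, if_neg h]

end Graph

/-! ### Counting cliques and places for a new node -/

section Count

open KTreeNode
open scoped Classical

variable {k n : ℕ}

/-- The children of a set of nodes. -/
noncomputable def childFinset (G : SimpleGraph (KTreeNode k n)) (C : Finset (KTreeNode k n)) :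
    Finset (Fin n) :=
  Finset.univ.filter fun i => parentFinset G i = C

/-- The number of ways to order the children of each clique of `G`. -/
noncomputable def orderings (G : SimpleGraph (KTreeNode k n)) : ℕ :=
  ∏ C : Finset (KTreeNode k n), (childFinset G C).card.factorial

theorem card_childFinset_map_emb (H : SimpleGraph (KTreeNode k (n + 1)))
    (C : Finset (KTreeNode k n)) :
    (childFinset H (C.map emb)).card =
      (childFinset (removeLast H) C).card + if C = attachSet H then 1 else 0 := by
  simp only [childFinset, Finset.card_filter, Fin.sum_univ_castSucc, parentFinset_castSucc,
    parentFinset_last, Finset.map_inj, eq_comm]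

/-- A node attached to a clique with `d` children can take `d + 1` positions among them. -/
theorem orderings_succ (H : SimpleGraph (KTreeNode k (n + 1))) :
    orderings H =
      orderings (removeLast H) * ((childFinset (removeLast H) (attachSet H)).card + 1) := by
  have h : ∏ C : Finset (KTreeNode k n), (childFinset H (C.map emb)).card.factorial =
      orderings H := by
    refine Fintype.prod_of_injective _ (Finset.map_injective emb) _ _ (fun S hS => ?_)
      fun _ => rfl
    suffices h : childFinset H S = ∅ by simp [h]
    refine Finset.filter_eq_empty_iff.2 fun i _ hi => hS ?_
    rcases Fin.eq_castSucc_or_eq_last i with ⟨i, rfl⟩ | rfl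
    · exact ⟨_, (parentFinset_castSucc H i).symm.trans hi⟩
    · exact ⟨_, (parentFinset_last H).symm.trans hi⟩
  have h2 : ∀ C : Finset (KTreeNode k n), (childFinset H (C.map emb)).card.factorial =
      (childFinset (removeLast H) C).card.factorial *
        if C = attachSet H then (childFinset (removeLast H) C).card + 1 else 1 := by
    intro C
    rw [card_childFinset_map_emb]
    split_ifs
    · rw [Nat.factorial_succ, mul_comm]
    · simp
  rw [← h, Finset.prod_congr rfl fun C _ => h2 C, Finset.prod_mul_distrib,
    Finset.prod_ite_eq' Finset.univ (attachSet H)]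
  simp [orderings]

/-- The `k`-cliques in which the inserted node `i` has the largest label. -/
noncomputable def cliquesWithMax (G : SimpleGraph (KTreeNode k n)) (i : Fin n) :
    Finset (Finset (KTreeNode k n)) :=
  (G.cliqueFinset k).filter fun C => Sum.inr i ∈ C ∧
    ∀ v ∈ C, v.label ≤ KTreeNode.label (Sum.inr i : KTreeNode k n)

theorem inr_notMem_parentFinset (G : SimpleGraph (KTreeNode k n)) (i : Fin n) :
    Sum.inr i ∉ parentFinset G i := by
  simp

theorem mem_parentFinset_of_mem_clique {G : SimpleGraph (KTreeNode k n)} {i : Fin n}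
    {C : Finset (KTreeNode k n)} (hC : C ∈ cliquesWithMax G i) {v : KTreeNode k n}
    (hv : v ∈ C) (hne : v ≠ Sum.inr i) : v ∈ parentFinset G i := by
  simp only [cliquesWithMax, Finset.mem_filter, SimpleGraph.mem_cliqueFinset_iff] at hC
  refine mem_parentFinset.2 ⟨hC.1.1 hC.2.1 hv hne.symm, (hC.2.2 v hv).lt_of_ne ?_⟩
  exact fun h => hne (eq_of_label_eq h)

/-- The cliques with the maximal node `i` arise from the parents of `i` by replacing one of them
with `i`. -/
theorem card_cliquesWithMax (hk : 1 ≤ k) {G : SimpleGraph (KTreeNode k n)}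
    (hG : IsIncreasingKTree G) (i : Fin n) : (cliquesWithMax G i).card = k := by
  have hi := inr_notMem_parentFinset G i
  have hN := (isIncreasingKTree_iff.1 hG).2 i
  have h : cliquesWithMax G i =
      ((parentFinset G i).powersetCard (k - 1)).image (insert (Sum.inr i)) := by
    ext C
    simp only [Finset.mem_image, Finset.mem_powersetCard]
    constructor
    · intro hC
      have hC' := hC
      simp only [cliquesWithMax, Finset.mem_filter, SimpleGraph.mem_cliqueFinset_iff] at hC'
      refine ⟨C.erase (Sum.inr i), ⟨fun v hv => ?_, ?_⟩, Finset.insert_erase hC'.2.1⟩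
      · exact mem_parentFinset_of_mem_clique hC (Finset.mem_of_mem_erase hv)
          (Finset.ne_of_mem_erase hv)
      · rw [Finset.card_erase_of_mem hC'.2.1, hC'.1.2]
    · rintro ⟨S, ⟨hS, hc⟩, rfl⟩
      simp only [cliquesWithMax, Finset.mem_filter, SimpleGraph.mem_cliqueFinset_iff]
      refine ⟨⟨?_, ?_⟩, Finset.mem_insert_self _ _, ?_⟩
      · rw [Finset.coe_insert]
        refine SimpleGraph.IsClique.insert (hN.1.subset (by exact_mod_cast hS)) ?_
        exact fun b hb _ => (mem_parentFinset.1 (hS hb)).1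
      · rw [Finset.card_insert_of_notMem fun h => hi (hS h), hc]
        omega
      · intro v hv
        rcases Finset.mem_insert.1 hv with rfl | hv
        · exact le_rfl
        · exact (mem_parentFinset.1 (hS hv)).2.le
  rw [h, Finset.card_image_of_injOn, Finset.card_powersetCard, hG.card_parentFinset,
    Nat.choose_symm hk, Nat.choose_one_right]
  intro S hS T hT hST
  have hS' := (Finset.mem_powersetCard.1 hS).1
  have hT' := (Finset.mem_powersetCard.1 hT).1
  rw [← Finset.erase_insert fun h => hi (hS' h), ← Finset.erase_insert fun h => hi (hT' h)]
  exact congrArg (fun X => Finset.erase X (Sum.inr i)) hST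

theorem pairwiseDisjoint_cliquesWithMax (G : SimpleGraph (KTreeNode k n)) (s : Set (Fin n)) :
    s.PairwiseDisjoint (cliquesWithMax G) := by
  intro i _ j _ hij
  refine Finset.disjoint_left.2 fun C hi hj => hij ?_
  simp only [cliquesWithMax, Finset.mem_filter] at hi hj
  have h := le_antisymm (hj.2.2 _ hi.2.1) (hi.2.2 _ hj.2.1)
  simpa using eq_of_label_eq h

/-- Every `k`-clique is the root clique or has an inserted node as its maximal node. -/
theorem eq_root_or_mem_cliquesWithMax {G : SimpleGraph (KTreeNode k n)}
    {C : Finset (KTreeNode k n)} (hC : C ∈ G.cliqueFinset k) :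
    C = Finset.univ.map ⟨Sum.inl, Sum.inl_injective⟩ ∨ ∃ i, C ∈ cliquesWithMax G i := by
  rcases C.eq_empty_or_nonempty with rfl | hne
  · left
    have h := ((SimpleGraph.mem_cliqueFinset_iff).1 hC).2
    rw [Finset.card_empty] at h
    exact (Finset.card_eq_zero.1 (by simp [← h])).symm
  obtain ⟨v, hv, hmax⟩ := C.exists_max_image KTreeNode.label hne
  rcases v with a | i
  · left
    refine Finset.eq_of_subset_of_card_le (fun w hw => ?_) ?_
    · have := hmax w hw
      rcases w with b | j
      · simp
      · simp [KTreeNode.label] at this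
    · rw [((SimpleGraph.mem_cliqueFinset_iff).1 hC).2]
      simp
  · exact Or.inr ⟨i, Finset.mem_filter.2 ⟨hC, hv, hmax⟩⟩

theorem card_cliqueFinset (hk : 1 ≤ k) {G : SimpleGraph (KTreeNode k n)}
    (hG : IsIncreasingKTree G) : (G.cliqueFinset k).card = k * n + 1 := by
  have h : G.cliqueFinset k = insert (Finset.univ.map ⟨Sum.inl, Sum.inl_injective⟩)
      (Finset.univ.biUnion (cliquesWithMax G)) := by
    ext C
    simp only [Finset.mem_insert, Finset.mem_biUnion, Finset.mem_univ, true_and]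
    refine ⟨eq_root_or_mem_cliquesWithMax, ?_⟩
    rintro (rfl | ⟨i, hi⟩)
    · rw [SimpleGraph.mem_cliqueFinset_iff]
      refine ⟨?_, by simp⟩
      simp only [Finset.coe_map, Function.Embedding.coeFn_mk, Finset.coe_univ, Set.image_univ]
      rintro _ ⟨a, rfl⟩ _ ⟨b, rfl⟩ h
      exact hG.root_clique a b fun hab => h (by rw [hab])
    · exact (Finset.mem_filter.1 hi).1
  rw [h, Finset.card_insert_of_notMem,
    Finset.card_biUnion (pairwiseDisjoint_cliquesWithMax G _)]
  · simp [card_cliquesWithMax hk hG, mul_comm]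
  · simp [cliquesWithMax]

theorem exists_inr_of_mem_descFinset {G : SimpleGraph (KTreeNode k n)} {j : Fin n}
    {w : KTreeNode k n} (h : w ∈ descFinset G (Sum.inr j)) : ∃ i, w = Sum.inr i := by
  rcases Relation.ReflTransGen.cases_tail (mem_descFinset.1 h) with h | ⟨y, _, i, hi, _⟩
  · exact ⟨j, h⟩
  · exact ⟨i, hi⟩

theorem card_filter_inr_mem_descFinset (G : SimpleGraph (KTreeNode k n)) (j : Fin n) :
    (Finset.univ.filter fun i => Sum.inr i ∈ descFinset G (Sum.inr j)).card =
      (descFinset G (Sum.inr j)).card := by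
  rw [← Finset.card_map ⟨(Sum.inr : Fin n → KTreeNode k n), Sum.inr_injective⟩]
  congr 1
  ext w
  simp only [Finset.mem_map, Finset.mem_filter, Finset.mem_univ, true_and,
    Function.Embedding.coeFn_mk]
  constructor
  · rintro ⟨i, hi, rfl⟩; exact hi
  · intro h
    obtain ⟨i, rfl⟩ := exists_inr_of_mem_descFinset h
    exact ⟨i, h, rfl⟩

/-- A `k`-clique contains a descendant of `j` exactly if its maximal node is one. -/
theorem card_cliqueFinset_meeting (hk : 1 ≤ k) {G : SimpleGraph (KTreeNode k n)}
    (hG : IsIncreasingKTree G) (j : Fin n) :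
    ((G.cliqueFinset k).filter fun C => ¬ Disjoint C (descFinset G (Sum.inr j))).card =
      k * (descFinset G (Sum.inr j)).card := by
  have h : ((G.cliqueFinset k).filter fun C => ¬ Disjoint C (descFinset G (Sum.inr j))) =
      (Finset.univ.filter fun i => Sum.inr i ∈ descFinset G (Sum.inr j)).biUnion
        (cliquesWithMax G) := by
    ext C
    simp only [Finset.mem_filter, Finset.mem_biUnion, Finset.mem_univ, true_and]
    constructor
    · rintro ⟨hC, hD⟩
      obtain ⟨u, hu, hd⟩ := Finset.not_disjoint_iff.1 hD
      rcases eq_root_or_mem_cliquesWithMax hC with rfl | ⟨i, hi⟩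
      · obtain ⟨i, rfl⟩ := exists_inr_of_mem_descFinset hd
        simp at hu
      · refine ⟨i, ?_, hi⟩
        rcases eq_or_ne u (Sum.inr i) with rfl | hne
        · exact hd
        · exact mem_descFinset.2 ((mem_descFinset.1 hd).tail
            ⟨i, rfl, mem_parentFinset_of_mem_clique hi hu hne⟩)
    · rintro ⟨i, hi, hC⟩
      have hC' := Finset.mem_filter.1 hC
      exact ⟨hC'.1, Finset.not_disjoint_iff.2 ⟨_, hC'.2.1, hi⟩⟩
  rw [h, Finset.card_biUnion (pairwiseDisjoint_cliquesWithMax G _)]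
  simp [card_cliquesWithMax hk hG, card_filter_inr_mem_descFinset, mul_comm, -mem_descFinset]

theorem sum_card_childFinset (G : SimpleGraph (KTreeNode k n))
    (s : Finset (Finset (KTreeNode k n))) :
    ∑ C ∈ s, (childFinset G C).card = (Finset.univ.filter fun i => parentFinset G i ∈ s).card := by
  rw [Finset.card_eq_sum_card_fiberwise (f := parentFinset G) (t := s)]
  · refine Finset.sum_congr rfl fun C hC => ?_
    congr 1
    ext i
    simp only [childFinset, Finset.mem_filter, Finset.mem_univ, true_and]
    exact ⟨fun h => ⟨h ▸ hC, h⟩, fun h => h.2⟩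
  · intro i hi
    simpa using hi

/-- A `k`-tree of size `n` has `(k + 1) n + 1` places for a new node. -/
theorem sum_places (hk : 1 ≤ k) {G : SimpleGraph (KTreeNode k n)} (hG : IsIncreasingKTree G) :
    ∑ C ∈ G.cliqueFinset k, ((childFinset G C).card + 1) = (k + 1) * n + 1 := by
  rw [Finset.sum_add_distrib, sum_card_childFinset, Finset.sum_const, card_cliqueFinset hk hG,
    Finset.filter_true_of_mem fun i _ =>
      (SimpleGraph.mem_cliqueFinset_iff).2 ((isIncreasingKTree_iff.1 hG).2 i)]
  simp only [Finset.card_univ, Fintype.card_fin, smul_eq_mul]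
  ring

theorem descFinset_card_pos (G : SimpleGraph (KTreeNode k n)) (u : KTreeNode k n) :
    0 < (descFinset G u).card :=
  Finset.card_pos.2 ⟨u, mem_descFinset.2 .refl⟩

/-- If `j` has `m` descendants, then a new node is a descendant of `j` in `(k + 1) m - 1` of its
places: there are `k m` cliques that contain a descendant of `j`, and the children of these cliques
are the `m - 1` descendants of `j` other than `j`. -/
theorem sum_places_meeting (hk : 1 ≤ k) {G : SimpleGraph (KTreeNode k n)}
    (hG : IsIncreasingKTree G) (j : Fin n) :
    (∑ C ∈ (G.cliqueFinset k).filter fun C => ¬ Disjoint C (descFinset G (Sum.inr j)),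
      ((childFinset G C).card + 1)) + 1 = (k + 1) * (descFinset G (Sum.inr j)).card := by
  have h : (Finset.univ.filter fun i => parentFinset G i ∈
      (G.cliqueFinset k).filter fun C => ¬ Disjoint C (descFinset G (Sum.inr j))) =
      (Finset.univ.filter fun i => Sum.inr i ∈ descFinset G (Sum.inr j)).erase j := by
    ext i
    simp only [Finset.mem_filter, Finset.mem_univ, true_and, Finset.mem_erase,
      SimpleGraph.mem_cliqueFinset_iff, (isIncreasingKTree_iff.1 hG).2 i]
    rw [Finset.not_disjoint_iff]
    constructor
    · rintro ⟨v, hv, hd⟩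
      refine ⟨?_, mem_descFinset.2 ((mem_descFinset.1 hd).tail ⟨i, rfl, hv⟩)⟩
      rintro rfl
      -- labels do not decrease from a node to its descendants
      have hle : ∀ w, Relation.ReflTransGen (IsParent G) (Sum.inr i) w →
          KTreeNode.label (Sum.inr i : KTreeNode k n) ≤ w.label := by
        intro w hw
        induction hw with
        | refl => exact le_rfl
        | tail _ h ih => exact ih.trans h.label_lt.le
      exact absurd (mem_parentFinset.1 hv).2 (hle v (mem_descFinset.1 hd)).not_gt
    · rintro ⟨hne, hd⟩
      rcases Relation.ReflTransGen.cases_tail (mem_descFinset.1 hd) with h | ⟨y, hy, i', hi, hyi⟩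
      · exact absurd (Sum.inr_injective h) hne
      · obtain rfl := Sum.inr_injective hi
        exact ⟨y, hyi, mem_descFinset.2 hy⟩
  have hpos := descFinset_card_pos G (Sum.inr j)
  have hj : j ∈ Finset.univ.filter fun i => Sum.inr i ∈ descFinset G (Sum.inr j) :=
    Finset.mem_filter.2 ⟨Finset.mem_univ _, mem_descFinset.2 .refl⟩
  rw [Finset.sum_add_distrib, sum_card_childFinset, h, Finset.card_erase_of_mem hj,
    card_filter_inr_mem_descFinset, Finset.sum_const, card_cliqueFinset_meeting hk hG]
  simp only [smul_eq_mul, mul_one]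
  rw [add_mul, one_mul]
  omega

end Count

/-! ### The growth of a random tree by one node -/

section Growth

open KTreeNode
open scoped Classical

variable {k n : ℕ}

/-- A tree is a graph together with an ordering of the children of each set of nodes. An ordering of
`d` children is encoded as an embedding into `Fin d`; sets of nodes without children contribute
nothing. -/
noncomputable def treeEquiv : OrderedIncreasingKTree k n ≃
    Σ G : {G : SimpleGraph (KTreeNode k n) // IsIncreasingKTree G},
      ∀ C : Finset (KTreeNode k n),
        {i // parentFinset G.1 i = C} ↪ Fin (childFinset G.1 C).card where
  toFun T := ⟨⟨T.graph, ⟨T.root_clique, T.parents_clique, T.parents_ncard⟩⟩, fun C =>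
    ⟨fun i => ⟨T.position i.1, by
      refine (T.position_lt i.1).trans_eq ?_
      rw [← Set.ncard_coe_finset]
      congr 1
      ext i'
      simp [childFinset, ← i.2, ← coe_parentFinset]⟩, by
      rintro ⟨i, rfl⟩ ⟨i', h⟩ hp
      refine Subtype.ext (T.position_inj i i' ?_ (by simpa using hp))
      rw [← coe_parentFinset, ← coe_parentFinset, h]⟩⟩
  invFun p :=
    { graph := p.1.1
      root_clique := p.1.2.root_clique
      parents_clique := p.1.2.parents_clique
      parents_ncard := p.1.2.parents_ncard
      position := fun i => p.2 (parentFinset p.1.1 i) ⟨i, rfl⟩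
      position_lt := fun i => by
        refine (Fin.is_lt _).trans_eq ?_
        rw [← Set.ncard_coe_finset]
        congr 1
        ext i'
        simp [childFinset, ← coe_parentFinset]
      position_inj := fun i i' h hp => by
        rw [← coe_parentFinset, ← coe_parentFinset, Finset.coe_inj] at h
        have key : ∀ (C : Finset (KTreeNode k n)) (hi : parentFinset p.1.1 i = C)
            (hi' : parentFinset p.1.1 i' = C), (p.2 C ⟨i, hi⟩ : ℕ) = p.2 C ⟨i', hi'⟩ → i = i' := by
          intro C hi hi' h
          simpa using (p.2 C).injective (Fin.ext h)
        refine key _ rfl h.symm (hp.trans ?_)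
        have key2 : ∀ (C : Finset (KTreeNode k n)) (hi' : parentFinset p.1.1 i' = C),
            (p.2 (parentFinset p.1.1 i') ⟨i', rfl⟩ : ℕ) = p.2 C ⟨i', hi'⟩ := by
          rintro C rfl
          rfl
        exact key2 _ h.symm }
  left_inv T := rfl
  right_inv p := by
    refine Sigma.ext rfl (heq_of_eq ?_)
    funext C
    ext ⟨i, rfl⟩
    rfl

/-- The number of trees whose graph has a given property. -/
noncomputable def countTrees (P : SimpleGraph (KTreeNode k n) → Prop) : ℕ :=
  ∑ G : SimpleGraph (KTreeNode k n) with IsIncreasingKTree G ∧ P G, orderings G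

theorem ncard_setOf_graph (P : SimpleGraph (KTreeNode k n) → Prop) :
    {T : OrderedIncreasingKTree k n | P T.graph}.ncard = countTrees P := by
  have e : {T : OrderedIncreasingKTree k n // P T.graph} ≃
      Σ G : {G : SimpleGraph (KTreeNode k n) // IsIncreasingKTree G ∧ P G},
        ∀ C : Finset (KTreeNode k n),
          {i // parentFinset G.1 i = C} ↪ Fin (childFinset G.1 C).card :=
    { toFun := fun T => ⟨⟨T.1.graph, (treeEquiv T.1).1.2, T.2⟩, (treeEquiv T.1).2⟩
      invFun := fun p => ⟨treeEquiv.symm ⟨⟨p.1.1, p.1.2.1⟩, p.2⟩, p.1.2.2⟩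
      left_inv := fun T => rfl
      right_inv := fun p => by
        refine Sigma.ext rfl (heq_of_eq ?_)
        funext C
        ext ⟨i, rfl⟩
        rfl }
  have hcard : ∀ G : SimpleGraph (KTreeNode k n), Nat.card (∀ C : Finset (KTreeNode k n),
      {i // parentFinset G i = C} ↪ Fin (childFinset G C).card) = orderings G := by
    intro G
    rw [Nat.card_pi]
    refine Finset.prod_congr rfl fun C _ => ?_
    rw [Nat.card_eq_fintype_card, Fintype.card_embedding_eq, Fintype.card_fin,
      Fintype.card_subtype, childFinset, Nat.descFactorial_self]
  rw [← Nat.card_coe_set_eq, Set.coe_ofPred, Nat.card_congr e, Nat.card_sigma,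
    Finset.sum_congr rfl fun G _ => hcard G.1, countTrees]
  exact (Finset.sum_subtype (Finset.univ.filter fun G => IsIncreasingKTree G ∧ P G)
    (by simp) fun G => orderings G).symm

/-- Removing the last node: a tree of size `n + 1` is a tree of size `n` with a place in it. -/
theorem countTrees_succ (P : SimpleGraph (KTreeNode k (n + 1)) → Prop) :
    countTrees P = ∑ G : SimpleGraph (KTreeNode k n) with IsIncreasingKTree G,
      orderings G * ∑ C ∈ (G.cliqueFinset k).filter (fun C => P (extendGraph G C)),
        ((childFinset G C).card + 1) := by
  have h : ∀ G : SimpleGraph (KTreeNode k n), (orderings G *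
      ∑ C ∈ (G.cliqueFinset k).filter (fun C => P (extendGraph G C)),
        ((childFinset G C).card + 1)) =
      ∑ C, if G.IsNClique k C ∧ P (extendGraph G C) then orderings (extendGraph G C) else 0 := by
    intro G
    rw [← Finset.sum_filter, Finset.mul_sum]
    refine Finset.sum_congr ?_ fun C _ => ?_
    · ext C; simp [SimpleGraph.mem_cliqueFinset_iff]
    · rw [orderings_succ]; simp
  rw [countTrees, Finset.sum_filter, ← Equiv.sum_comp graphEquiv.symm, Fintype.sum_prod_type,
    Finset.sum_filter]
  refine Finset.sum_congr rfl fun G _ => ?_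
  rw [h, ← Finset.sum_filter, ← Finset.sum_filter]
  have h2 : ∀ C, graphEquiv.symm (G, C) = extendGraph G C := fun _ => rfl
  simp only [h2, isIncreasingKTree_succ_iff, removeLast_extendGraph, attachSet_extendGraph]
  by_cases hG : IsIncreasingKTree G
  · simp [hG]
  · simp [hG]

theorem countTrees_true_succ (hk : 1 ≤ k) :
    countTrees (fun _ : SimpleGraph (KTreeNode k (n + 1)) => True) =
      ((k + 1) * n + 1) * countTrees (fun _ : SimpleGraph (KTreeNode k n) => True) := by
  rw [countTrees_succ, countTrees, Finset.mul_sum]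
  simp only [Finset.filter_true, and_true]
  refine Finset.sum_congr rfl fun G hG => ?_
  rw [sum_places hk (Finset.mem_filter.1 hG).2, mul_comm]

/-- The last node has no descendant but itself. -/
theorem countTrees_last (m : ℕ) :
    countTrees (fun G : SimpleGraph (KTreeNode k (n + 1)) =>
      (descFinset G (Sum.inr (Fin.last n))).card = m) =
    if m = 1 then countTrees (fun _ : SimpleGraph (KTreeNode k (n + 1)) => True) else 0 := by
  have h : ∀ G : SimpleGraph (KTreeNode k (n + 1)),
      (descFinset G (Sum.inr (Fin.last n))).card = 1 := by
    intro G
    have := descFinset_last G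
    rw [last] at this
    rw [this, Finset.card_singleton]
  split_ifs with hm
  · simp [countTrees, h, hm]
  · simp [countTrees, h, Ne.symm hm]

theorem countTrees_zero (j : Fin n) :
    countTrees (fun G : SimpleGraph (KTreeNode k n) =>
      (descFinset G (Sum.inr j)).card = 0) = 0 := by
  simp [countTrees, (descFinset_card_pos _ _).ne', -Finset.card_eq_zero]

/-- The growth step of the urn: a tree with `m` descendants of `j` has `(k + 1) m - 1` places at
which the new node is a descendant of `j`, and a tree with `m + 1` of them has
`(k + 1) n + 2 - (k + 1) (m + 1)` places at which it is not. -/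
theorem countTrees_castSucc (hk : 1 ≤ k) (j : Fin n) (m : ℕ) :
    (countTrees (fun G : SimpleGraph (KTreeNode k (n + 1)) =>
      (descFinset G (Sum.inr j.castSucc)).card = m + 1) : ℝ) =
    ((k + 1) * m - 1) * countTrees (fun G : SimpleGraph (KTreeNode k n) =>
      (descFinset G (Sum.inr j)).card = m) +
    ((k + 1) * n + 2 - (k + 1) * (m + 1)) * countTrees (fun G : SimpleGraph (KTreeNode k n) =>
      (descFinset G (Sum.inr j)).card = m + 1) := by
  rw [countTrees_succ, countTrees, countTrees]
  push_cast
  have hsum : ∀ (Q : SimpleGraph (KTreeNode k n) → Prop) (f : SimpleGraph (KTreeNode k n) → ℝ),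
      ∑ G with IsIncreasingKTree G ∧ Q G, f G =
        ∑ G with IsIncreasingKTree G, if Q G then f G else 0 := by
    intro Q f
    rw [← Finset.filter_filter, Finset.sum_filter]
  rw [Finset.mul_sum, Finset.mul_sum, hsum, hsum, ← Finset.sum_add_distrib]
  refine Finset.sum_congr rfl fun G hG => ?_
  have hG' := (Finset.mem_filter.1 hG).2
  have h1 := sum_places_meeting hk hG' j
  have h2 := sum_places hk hG'
  rw [← Finset.sum_filter_add_sum_filter_not _
    fun C => ¬ Disjoint C (descFinset G (Sum.inr j))] at h2
  simp only [not_not] at h2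
  -- a tree of size `n` contributes to the left-hand side only if `j` has `m` descendants in it and
  -- the new node is one, or if `j` has `m + 1` descendants in it and the new node is none
  have h3 : ∀ C, (descFinset (extendGraph G C) (Sum.inr j.castSucc)).card =
      (descFinset G (Sum.inr j)).card +
        if Disjoint C (descFinset G (Sum.inr j)) then 0 else 1 := by
    intro C
    have := card_descFinset_emb (extendGraph G C) (Sum.inr j)
    simpa using this
  simp only [h3]
  set D := descFinset G (Sum.inr j)
  by_cases hm : D.card = m
  · have h4 : ∀ C, (D.card + (if Disjoint C D then 0 else 1) = m + 1) ↔ ¬ Disjoint C D := by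
      intro C; split_ifs with h <;> simp [h, hm]
    simp only [h4]
    simp only [hm, if_true]
    rw [hm] at h1
    have h1' := congrArg (Nat.cast : ℕ → ℝ) h1
    push_cast at h1'
    rw [eq_sub_of_add_eq h1', if_neg (by omega)]
    ring
  · by_cases hm1 : D.card = m + 1
    · have h4 : ∀ C, (D.card + (if Disjoint C D then 0 else 1) = m + 1) ↔ Disjoint C D := by
        intro C; split_ifs with h <;> simp [h, hm1]
      simp only [h4]
      simp only [hm1, if_true]
      rw [hm1] at h1
      have h1' := congrArg (Nat.cast : ℕ → ℝ) h1
      have h2' := congrArg (Nat.cast : ℕ → ℝ) h2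
      push_cast at h1' h2'
      rw [if_neg (by omega)]
      linear_combination (orderings G : ℝ) * (h2' - h1')
    · have h4 : ∀ C, ¬ (D.card + (if Disjoint C D then 0 else 1) = m + 1) := by
        intro C; split_ifs with h <;> omega
      simp [h4, hm, hm1]

end Growth

section NumDescendants

open KTreeNode
open scoped Classical

variable {k n : ℕ}

theorem isDescendant_iff (T : OrderedIncreasingKTree k n) (u w : KTreeNode k n) :
    T.IsDescendant u w ↔ w ∈ descFinset T.graph u := by
  rw [mem_descFinset]
  constructor
  · intro h
    induction h with
    | refl => exact .refl
    | step v i hv _ ih => exact ih.tail ⟨i, rfl, mem_parentFinset.2 hv⟩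
  · intro h
    induction h with
    | refl => exact .refl
    | tail _ h ih =>
      obtain ⟨i, rfl, hv⟩ := h
      exact .step _ i (mem_parentFinset.1 hv) ih

/-- The inserted node with index `j` has the label `j + 1`. -/
theorem numDescendants_eq (T : OrderedIncreasingKTree k n) (j : Fin n) :
    T.numDescendants (j + 1) = (descFinset T.graph (Sum.inr j)).card := by
  rw [OrderedIncreasingKTree.numDescendants, ← Set.ncard_coe_finset]
  congr 1
  ext w
  simp only [Set.mem_ofPred_eq, isDescendant_iff, KTreeNode.label, Nat.add_right_cancel_iff,
    Finset.mem_coe]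
  exact ⟨fun ⟨i, hi, h⟩ => Fin.ext hi ▸ h, fun h => ⟨j, rfl, h⟩⟩

theorem randomKTree_real_eq (P : SimpleGraph (KTreeNode k n) → Prop) :
    (randomKTree k n).real {T | P T.graph} =
      countTrees P / countTrees (fun _ : SimpleGraph (KTreeNode k n) => True) := by
  have := Fintype.ofFinite (OrderedIncreasingKTree k n)
  rw [measureReal_def, randomKTree, uniformOn_univ, ← ncard_setOf_graph, ← ncard_setOf_graph,
    ENNReal.toReal_div, Measure.count_apply (by trivial)]
  have h : {T : OrderedIncreasingKTree k n | True} = Set.univ := rfl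
  rw [h, Set.ncard_univ, Nat.card_eq_fintype_card, ENNReal.toReal_natCast]
  congr 1
  rw [← Set.Finite.cast_ncard_eq (Set.toFinite _), ENat.toENNReal_coe, ENNReal.toReal_natCast]

theorem countTrees_true_pos :
    0 < countTrees (fun _ : SimpleGraph (KTreeNode k n) => True) := by
  rw [← ncard_setOf_graph, Set.ncard_pos (Set.toFinite _)]
  exact ⟨Classical.arbitrary _, trivial⟩

end NumDescendants

/-! ### The exact distribution -/

/-- The mass that the beta-binomial distribution gives to `i`: the probability of `i` successes in
`N` trials whose success probability is itself beta distributed with parameters `α` and `β`. -/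
noncomputable def betaBinomial (α β : ℝ) (N i : ℕ) : ℝ :=
  N.choose i * (ascPochhammer ℝ i).eval α * (ascPochhammer ℝ (N - i)).eval β /
    (ascPochhammer ℝ N).eval (α + β)

theorem ascPochhammer_eval_pos {x : ℝ} (hx : 0 < x) (n : ℕ) : 0 < (ascPochhammer ℝ n).eval x :=
  ascPochhammer_pos n x hx

/-- The recursion of Pólya's urn. -/
theorem betaBinomial_succ_succ {α β : ℝ} (hα : 0 < α) (hβ : 0 < β) (N i : ℕ) :
    betaBinomial α β (N + 1) (i + 1) * (α + β + N) =
      betaBinomial α β N i * (α + i) + betaBinomial α β N (i + 1) * (β + N - (i + 1)) := by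
  have hD := (ascPochhammer_eval_pos (add_pos hα hβ) N).ne'
  have hD' : α + β + N ≠ 0 := by positivity
  rcases lt_trichotomy N i with h | rfl | h
  · simp [betaBinomial, Nat.choose_eq_zero_of_lt h,
      Nat.choose_eq_zero_of_lt (h.trans i.lt_succ_self),
      Nat.choose_eq_zero_of_lt (Nat.succ_lt_succ h)]
  · simp only [betaBinomial, ascPochhammer_succ_eval, Nat.choose_self, Nat.choose_succ_self,
      Nat.sub_self, Nat.cast_one, Nat.cast_zero]
    field_simp
    ring
  · obtain ⟨d, rfl⟩ := Nat.exists_eq_add_of_lt h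
    have e1 : i + d + 1 - i = d + 1 := by omega
    have e2 : i + d + 1 - (i + 1) = d := by omega
    have e3 : i + d + 1 + 1 - (i + 1) = d + 1 := by omega
    simp only [betaBinomial, e1, e2, e3, Nat.choose_succ_succ (i + d + 1) i]
    rw [ascPochhammer_succ_eval (S := ℝ) (i + d + 1), ascPochhammer_succ_eval (S := ℝ) i,
      ascPochhammer_succ_eval (S := ℝ) d]
    push_cast at hD' ⊢
    field_simp
    ring

theorem betaBinomial_succ_zero {α β : ℝ} (hα : 0 < α) (hβ : 0 < β) (N : ℕ) :
    betaBinomial α β (N + 1) 0 * (α + β + N) = betaBinomial α β N 0 * (β + N) := by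
  have hD := (ascPochhammer_eval_pos (add_pos hα hβ) N).ne'
  have hD' : α + β + N ≠ 0 := by positivity
  simp only [betaBinomial, ascPochhammer_succ_eval, Nat.choose_zero_right, Nat.sub_zero]
  field_simp

theorem gbinom_eq_ascPochhammer (x : ℝ) (l : ℕ) :
    gbinom (x + l - 1) l = (ascPochhammer ℝ l).eval x / l.factorial := by
  rw [gbinom, if_pos (Int.natCast_nonneg l), Int.toNat_natCast, ← Ring.multichoose_eq,
    eq_div_iff (by positivity), mul_comm, ← nsmul_eq_mul,
    Ring.factorial_nsmul_multichoose_eq_ascPochhammer, Polynomial.ascPochhammer_smeval_eq_eval]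

section

variable {k : ℕ}

theorem randomKTree_real_numDescendants_ratio {n : ℕ} (j : Fin n) (m : ℕ) :
    (randomKTree k n).real {T | T.numDescendants (j + 1) = m} =
      countTrees (fun G : SimpleGraph (KTreeNode k n) => (descFinset G (Sum.inr j)).card = m) /
        countTrees (fun _ : SimpleGraph (KTreeNode k n) => True) := by
  simp only [numDescendants_eq]
  exact randomKTree_real_eq fun G => (descFinset G (Sum.inr j)).card = m

theorem randomKTree_real_numDescendants_eq_zero {n : ℕ} (j : Fin n) :
    (randomKTree k n).real {T | T.numDescendants (j + 1) = 0} = 0 := by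
  rw [randomKTree_real_numDescendants_ratio, countTrees_zero]
  simp

/-- When the tree grows, the number of descendants evolves like Pólya's urn, started when node
`j + 1` is inserted. -/
theorem randomKTree_real_numDescendants (hk : 1 ≤ k) (j N i : ℕ) :
    (randomKTree k (j + 1 + N)).real {T | T.numDescendants (j + 1) = i + 1} =
      betaBinomial (k / (k + 1)) (j + 2 / (k + 1)) N i := by
  have hk' : (0 : ℝ) < k := by exact_mod_cast hk
  have hα : (0 : ℝ) < k / (k + 1) := by positivity
  have hβ : (0 : ℝ) < j + 2 / (k + 1) := by positivity
  have hrec : ∀ (N m : ℕ), (randomKTree k (j + 1 + (N + 1))).real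
      {T | T.numDescendants (j + 1) = m + 1} * (k / (k + 1) + (j + 2 / (k + 1)) + N) =
      (randomKTree k (j + 1 + N)).real {T | T.numDescendants (j + 1) = m} * (m - 1 / (k + 1)) +
      (randomKTree k (j + 1 + N)).real {T | T.numDescendants (j + 1) = m + 1} *
        (j + 2 / (k + 1) + N - m) := by
    intro N m
    have h1 := randomKTree_real_numDescendants_ratio (k := k) (n := j + 1 + N) ⟨j, by omega⟩
    have h2 := randomKTree_real_numDescendants_ratio (k := k) (n := j + 1 + (N + 1)) ⟨j, by omega⟩
    have h3 := countTrees_castSucc hk (n := j + 1 + N) ⟨j, by omega⟩ m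
    have h4 := countTrees_true_succ hk (n := j + 1 + N)
    have h5 := countTrees_true_pos (k := k) (n := j + 1 + N)
    have h5' : (0 : ℝ) < countTrees (fun _ : SimpleGraph (KTreeNode k (j + 1 + N)) => True) := by
      exact_mod_cast h5
    simp only at h1 h2
    rw [h1, h1, h2]
    rw [show (countTrees (fun _ : SimpleGraph (KTreeNode k (j + 1 + (N + 1))) => True)) = _ from h4]
    rw [show (countTrees (fun G : SimpleGraph (KTreeNode k (j + 1 + (N + 1))) =>
      (descFinset G (Sum.inr ⟨j, by omega⟩)).card = m + 1) : ℝ) = _ from h3]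
    push_cast
    field_simp
    ring
  induction N generalizing i with
  | zero =>
    have h1 := randomKTree_real_numDescendants_ratio (k := k) (n := j + 1) (Fin.last j) (i + 1)
    have h5 := countTrees_true_pos (k := k) (n := j + 1)
    simp only [Fin.val_last] at h1
    rw [add_zero, h1, countTrees_last]
    rcases i with _ | i
    · simp [betaBinomial, h5.ne']
    · simp [betaBinomial]
  | succ N ih =>
    have hpos : (k : ℝ) / (k + 1) + (j + 2 / (k + 1)) + N ≠ 0 := by positivity
    refine mul_right_cancel₀ hpos ?_
    have hα' : (k : ℝ) / (k + 1) = 1 - 1 / (k + 1) := by field_simp; ring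
    rcases i with _ | i
    · have h0 := randomKTree_real_numDescendants_eq_zero (k := k) (n := j + 1 + N) ⟨j, by omega⟩
      simp only at h0
      rw [hrec N 0, h0, ih, betaBinomial_succ_zero hα hβ]
      push_cast
      ring
    · rw [hrec N (i + 1), ih, ih, betaBinomial_succ_succ hα hβ, hα']
      push_cast
      ring

/-- The beta-binomial probabilities in terms of generalized binomial coefficients. -/
theorem betaBinomial_eq_gbinom {α β : ℝ} {N i : ℕ} (h : i ≤ N) :
    betaBinomial α β N i =
      gbinom (α + i - 1) i * gbinom (β + (N - i : ℕ) - 1) (N - i : ℕ) /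
        gbinom (α + β + N - 1) N := by
  rw [gbinom_eq_ascPochhammer, gbinom_eq_ascPochhammer, gbinom_eq_ascPochhammer, betaBinomial,
    Nat.cast_choose ℝ h]
  have h1 : (i.factorial : ℝ) ≠ 0 := by positivity
  have h2 : ((N - i).factorial : ℝ) ≠ 0 := by positivity
  have h3 : (N.factorial : ℝ) ≠ 0 := by positivity
  field_simp

theorem randomKTree_real_numDescendants_eq_gbinom (hk : 1 ≤ k) {n j m : ℕ} (hj : 1 ≤ j)
    (hjn : j ≤ n) (hm : 1 ≤ m) :
    (randomKTree k n).real {T | T.numDescendants j = m} =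
      gbinom ((m : ℝ) - 1 - 1 / ((k : ℝ) + 1)) ((m : ℤ) - 1) *
        gbinom ((n : ℝ) - m - 1 + 2 / ((k : ℝ) + 1)) ((n : ℤ) - m - j + 1) /
          gbinom ((n : ℝ) - (k : ℝ) / ((k : ℝ) + 1)) ((n : ℤ) - j) := by
  obtain ⟨i, rfl⟩ := Nat.exists_eq_add_of_le' hm
  obtain ⟨l, rfl⟩ := Nat.exists_eq_add_of_le' hj
  obtain ⟨N, rfl⟩ := Nat.exists_eq_add_of_le hjn
  have hk1 : (k : ℝ) + 1 ≠ 0 := by positivity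
  rw [randomKTree_real_numDescendants hk]
  rcases le_or_gt i N with h | h
  · rw [betaBinomial_eq_gbinom h]
    congr 2
    · congr 1
      · push_cast; field_simp; ring
      · push_cast; ring
    · congr 1
      · push_cast [Nat.cast_sub h]; ring
      · push_cast [Nat.cast_sub h]; ring
    · push_cast; field_simp; ring
    · push_cast; ring
  · have hneg : ¬ (0 : ℤ) ≤ ((l + 1 + N : ℕ) : ℤ) - (i + 1 : ℕ) - (l + 1 : ℕ) + 1 := by
      push_cast; omega
    rw [betaBinomial, Nat.choose_eq_zero_of_lt h]
    simp only [gbinom, if_neg hneg]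
    simp

end

/-! ### Moments of the beta and gamma distributions -/

theorem Gamma_add_natCast {x : ℝ} (hx : 0 < x) (n : ℕ) :
    Real.Gamma (x + n) = (ascPochhammer ℝ n).eval x * Real.Gamma x := by
  induction n with
  | zero => simp
  | succ n ih =>
    have h : x + n ≠ 0 := by positivity
    rw [Nat.cast_succ, ← add_assoc, Real.Gamma_add_one h, ih, ascPochhammer_succ_eval]
    ring

theorem beta_add_natCast {α β : ℝ} (hα : 0 < α) (hβ : 0 < β) (i l : ℕ) :
    beta (α + i) (β + l) = (ascPochhammer ℝ i).eval α * (ascPochhammer ℝ l).eval β /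
      (ascPochhammer ℝ (i + l)).eval (α + β) * beta α β := by
  have h : α + i + (β + l) = α + β + (i + l : ℕ) := by push_cast; ring
  rw [beta, beta, h, Gamma_add_natCast hα, Gamma_add_natCast hβ, Gamma_add_natCast (add_pos hα hβ)]
  have h1 := (ascPochhammer_eval_pos (add_pos hα hβ) (i + l)).ne'
  have h2 := (Real.Gamma_pos_of_pos (add_pos hα hβ)).ne'
  field_simp

theorem betaPDFReal_nonneg {α β : ℝ} (hα : 0 < α) (hβ : 0 < β) (x : ℝ) :
    0 ≤ betaPDFReal α β x := by
  by_cases h : 0 < x ∧ x < 1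
  · exact (betaPDFReal_pos h.1 h.2 hα hβ).le
  · rw [betaPDFReal, if_neg h]

theorem measurable_betaPDF (α β : ℝ) : Measurable (betaPDF α β) :=
  (measurable_betaPDFReal α β).ennreal_ofReal

theorem integral_betaPDFReal {α β : ℝ} (hα : 0 < α) (hβ : 0 < β) :
    ∫ x, betaPDFReal α β x = 1 := by
  rw [integral_eq_lintegral_of_nonneg_ae (ae_of_all _ (betaPDFReal_nonneg hα hβ))
    (by fun_prop)]
  exact (ENNReal.toReal_eq_one_iff _).2 (lintegral_betaPDF_eq_one hα hβ)

theorem ae_mem_Ioo_betaMeasure (α β : ℝ) : ∀ᵐ x ∂betaMeasure α β, x ∈ Set.Ioo (0 : ℝ) 1 := by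
  rw [betaMeasure, ae_withDensity_iff (measurable_betaPDF α β)]
  refine ae_of_all _ fun x hx => ?_
  by_contra h
  exact hx (by rw [betaPDF, betaPDFReal, if_neg (show ¬ (0 < x ∧ x < 1) from h),
    ENNReal.ofReal_zero])

theorem integrable_betaMeasure {α β : ℝ} (hα : 0 < α) (hβ : 0 < β) {g : ℝ → ℝ}
    (hg : Continuous g) : Integrable g (betaMeasure α β) := by
  have := isProbabilityMeasureBeta hα hβ
  obtain ⟨C, hC⟩ := isCompact_Icc.exists_bound_of_continuousOn
    (s := Set.Icc (0 : ℝ) 1) hg.continuousOn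
  exact Integrable.of_bound hg.aestronglyMeasurable C
    ((ae_mem_Ioo_betaMeasure α β).mono fun x hx => hC x (Set.Ioo_subset_Icc_self hx))

/-- Multiplying the density by `x ^ i * (1 - x) ^ l` gives a multiple of the density with the
parameters `α + i` and `β + l`. -/
theorem integral_pow_mul_betaMeasure {α β : ℝ} (hα : 0 < α) (hβ : 0 < β) (i l : ℕ) :
    ∫ x, x ^ i * (1 - x) ^ l ∂betaMeasure α β =
      (ascPochhammer ℝ i).eval α * (ascPochhammer ℝ l).eval β /
        (ascPochhammer ℝ (i + l)).eval (α + β) := by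
  have hαi : 0 < α + i := by positivity
  have hβl : 0 < β + l := by positivity
  have hB := beta_pos hα hβ
  have hB' := beta_pos hαi hβl
  have h : ∀ x, (betaPDF α β x).toReal • (x ^ i * (1 - x) ^ l) =
      beta (α + i) (β + l) / beta α β * betaPDFReal (α + i) (β + l) x := by
    intro x
    rw [betaPDF, ENNReal.toReal_ofReal (betaPDFReal_nonneg hα hβ x), smul_eq_mul]
    by_cases hx : 0 < x ∧ x < 1
    · rw [betaPDFReal, betaPDFReal, if_pos hx, if_pos hx,
        show α + i - 1 = α - 1 + i by ring, show β + l - 1 = β - 1 + l by ring,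
        Real.rpow_add_natCast hx.1.ne', Real.rpow_add_natCast (sub_pos.2 hx.2).ne']
      field_simp
    · rw [betaPDFReal, betaPDFReal, if_neg hx, if_neg hx]
      simp
  rw [betaMeasure, integral_withDensity_eq_integral_toReal_smul (measurable_betaPDF α β)
    (ae_of_all _ fun x => ENNReal.ofReal_lt_top), integral_congr_ae (ae_of_all _ h),
    integral_const_mul, integral_betaPDFReal hαi hβl, beta_add_natCast hα hβ]
  field_simp

theorem integral_pow_betaMeasure {α β : ℝ} (hα : 0 < α) (hβ : 0 < β) (s : ℕ) :
    ∫ x, x ^ s ∂betaMeasure α β =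
      (ascPochhammer ℝ s).eval α / (ascPochhammer ℝ s).eval (α + β) := by
  simpa using integral_pow_mul_betaMeasure hα hβ s 0

theorem measurable_gammaPDF (a r : ℝ) : Measurable (gammaPDF a r) :=
  (measurable_gammaPDFReal a r).ennreal_ofReal

theorem gammaMeasure_moment {a : ℝ} (ha : 0 < a) (s : ℕ) :
    Integrable (fun x : ℝ => x ^ s) (gammaMeasure a 1) ∧
      ∫ x, x ^ s ∂gammaMeasure a 1 = (ascPochhammer ℝ s).eval a := by
  have has : 0 < a + s := by positivity
  have hG := Real.Gamma_pos_of_pos ha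
  have hG' := Real.Gamma_pos_of_pos has
  have h : ∀ᵐ x : ℝ, (gammaPDF a 1 x).toReal • x ^ s =
      (ascPochhammer ℝ s).eval a * gammaPDFReal (a + s) 1 x := by
    -- the addition formula for `Real.rpow` with a possibly negative exponent needs a nonzero base
    have h0 : ∀ᵐ x : ℝ, x ≠ 0 := by simp [ae_iff]
    filter_upwards [h0] with x hx0
    rw [gammaPDF, ENNReal.toReal_ofReal (gammaPDFReal_nonneg ha one_pos x), smul_eq_mul]
    by_cases hx : 0 ≤ x
    · rw [gammaPDFReal, gammaPDFReal, if_pos hx, if_pos hx,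
        show a + s - 1 = a - 1 + s by ring, Real.rpow_add_natCast hx0,
        Gamma_add_natCast ha]
      have := (ascPochhammer_eval_pos ha s).ne'
      simp only [Real.one_rpow]
      field_simp
    · rw [gammaPDFReal, gammaPDFReal, if_neg hx, if_neg hx]
      simp
  have hint : ∫ x, gammaPDFReal (a + s) 1 x = 1 := by
    rw [integral_eq_lintegral_of_nonneg_ae (ae_of_all _ (gammaPDFReal_nonneg has one_pos))
      (by fun_prop)]
    exact (ENNReal.toReal_eq_one_iff _).2 (lintegral_gammaPDF_eq_one has one_pos)
  constructor
  · rw [gammaMeasure, integrable_withDensity_iff_integrable_smul' (measurable_gammaPDF a 1)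
      (ae_of_all _ fun x => ENNReal.ofReal_lt_top), integrable_congr h]
    refine Integrable.const_mul ?_ _
    exact Integrable.of_integral_ne_zero (by rw [hint]; exact one_ne_zero)
  · rw [gammaMeasure, integral_withDensity_eq_integral_toReal_smul (measurable_gammaPDF a 1)
      (ae_of_all _ fun x => ENNReal.ofReal_lt_top), integral_congr_ae h, integral_const_mul, hint,
      mul_one]

/-! ### Asymptotics of quotients of gamma values -/

/-- Wendel's inequality, a consequence of the logarithmic convexity of the gamma function. -/
theorem Gamma_add_le {x s : ℝ} (hx : 0 < x) (hs : 0 < s) (hs1 : s < 1) :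
    Real.Gamma (x + s) ≤ x ^ s * Real.Gamma x := by
  have h := Real.Gamma_mul_add_mul_le_rpow_Gamma_mul_rpow_Gamma hx (add_pos hx one_pos)
    (sub_pos.2 hs1) hs (by ring)
  have hG := Real.Gamma_pos_of_pos hx
  rw [show (1 - s) * x + s * (x + 1) = x + s by ring, Real.Gamma_add_one hx.ne',
    Real.mul_rpow hx.le hG.le, mul_left_comm, ← Real.rpow_add hG, sub_add_cancel,
    Real.rpow_one] at h
  exact h

theorem tendsto_Gamma_add_div {s : ℝ} (hs : 0 < s) (hs1 : s < 1) :
    Tendsto (fun x => Real.Gamma (x + s) / (Real.Gamma x * x ^ s)) atTop (𝓝 1) := by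
  have hlow : Tendsto (fun x : ℝ => (x / (x + s)) ^ (1 - s)) atTop (𝓝 1) := by
    have h : Tendsto (fun x : ℝ => x / (x + s)) atTop (𝓝 1) := by
      have h1 : Tendsto (fun x : ℝ => 1 - s / (x + s)) atTop (𝓝 (1 - 0)) :=
        tendsto_const_nhds.sub (tendsto_const_nhds.div_atTop
          (tendsto_atTop_add_const_right _ _ tendsto_id))
      rw [sub_zero] at h1
      refine h1.congr' ?_
      filter_upwards [eventually_gt_atTop 0] with x hx
      have : x + s ≠ 0 := by positivity
      field_simp
      ring
    simpa using h.rpow_const (p := 1 - s) (Or.inl one_ne_zero)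
  refine tendsto_of_tendsto_of_tendsto_of_le_of_le' hlow tendsto_const_nhds ?_ ?_
  -- the lower bound is the inequality at `x + s` with the exponent `1 - s`
  · filter_upwards [eventually_gt_atTop 0] with x hx
    have hxs : 0 < x + s := by positivity
    have hG := Real.Gamma_pos_of_pos hx
    have h := Gamma_add_le hxs (sub_pos.2 hs1) (by linarith)
    rw [show x + s + (1 - s) = x + 1 by ring, Real.Gamma_add_one hx.ne'] at h
    rw [le_div_iff₀ (by positivity), Real.div_rpow hx.le hxs.le, div_mul_eq_mul_div,
      div_le_iff₀ (by positivity)]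
    have hx1 : x ^ (1 - s) * x ^ s = x := by
      rw [← Real.rpow_add hx, sub_add_cancel, Real.rpow_one]
    calc x ^ (1 - s) * (Real.Gamma x * x ^ s) = x * Real.Gamma x := by
          rw [mul_left_comm, hx1, mul_comm]
      _ ≤ _ := h.trans_eq (mul_comm _ _)
  · filter_upwards [eventually_gt_atTop 0] with x hx
    have hG := Real.Gamma_pos_of_pos hx
    rw [div_le_one (by positivity), mul_comm]
    exact Gamma_add_le hx hs hs1

/-! ### Convergence of densities -/

/-- Pointwise convergence of densities gives one half of the portmanteau theorem, by Fatou's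
lemma. -/
theorem withDensity_apply_le_liminf {Ω : Type*} [MeasurableSpace Ω] {μ : Measure Ω}
    {f : ℕ → Ω → ENNReal} {g : Ω → ENNReal} (hf : ∀ n, Measurable (f n))
    (h : ∀ᵐ x ∂μ, Tendsto (fun n => f n x) atTop (𝓝 (g x))) {s : Set Ω} (hs : MeasurableSet s) :
    μ.withDensity g s ≤ liminf (fun n => μ.withDensity (f n) s) atTop := by
  rw [withDensity_apply _ hs]
  simp only [withDensity_apply _ hs]
  refine le_trans (le_of_eq ?_) (lintegral_liminf_le hf)
  exact lintegral_congr_ae ((ae_restrict_of_ae h).mono fun x hx => hx.liminf_eq.symm)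

/-- The density of a multiple of a beta distributed random variable. -/
theorem map_mul_betaMeasure {α β c : ℝ} (hc : 0 < c) :
    (betaMeasure α β).map (fun x => c * x) =
      volume.withDensity fun y => ENNReal.ofReal (betaPDFReal α β (c⁻¹ * y) / c) := by
  ext s hs
  rw [Measure.map_apply (by fun_prop) hs, betaMeasure,
    withDensity_apply _ (measurableSet_preimage (by fun_prop) hs), withDensity_apply _ hs,
    ← lintegral_indicator (measurableSet_preimage (by fun_prop) hs), ← lintegral_indicator hs]
  have h1 : ∀ x, ((fun x => c * x) ⁻¹' s).indicator (betaPDF α β) x =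
      s.indicator (fun y => betaPDF α β (c⁻¹ * y)) (c * x) := by
    intro x
    by_cases hx : c * x ∈ s
    · rw [Set.indicator_of_mem hx, Set.indicator_of_mem (Set.mem_preimage.2 hx),
        inv_mul_cancel_left₀ hc.ne']
    · rw [Set.indicator_of_notMem hx, Set.indicator_of_notMem (by simpa using hx)]
  have hm : Measurable fun y => betaPDF α β (c⁻¹ * y) :=
    (measurable_betaPDF α β).comp (by fun_prop)
  rw [lintegral_congr h1, ← lintegral_map (f := s.indicator fun y => betaPDF α β (c⁻¹ * y))
    (hm.indicator hs) (by fun_prop : Measurable fun x : ℝ => c * x),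
    Real.map_volume_mul_left hc.ne', lintegral_smul_measure, smul_eq_mul,
    ← lintegral_const_mul _ (hm.indicator hs)]
  refine lintegral_congr fun y => ?_
  by_cases hy : y ∈ s
  · rw [Set.indicator_of_mem hy, Set.indicator_of_mem hy, betaPDF,
      ← ENNReal.ofReal_mul (abs_nonneg _), abs_of_pos (inv_pos.2 hc), div_eq_inv_mul]
  · rw [Set.indicator_of_notMem hy, Set.indicator_of_notMem hy, mul_zero]

theorem tendsto_one_sub_div_rpow {β c : ℕ → ℝ} (hβ : Tendsto β atTop atTop)
    (hc : Tendsto c atTop atTop) (hβc : Tendsto (fun n => c n / β n) atTop (𝓝 1)) (y : ℝ) :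
    Tendsto (fun n => (1 - (c n)⁻¹ * y) ^ (β n - 1)) atTop (𝓝 (Real.exp (-y))) := by
  have h1 : Tendsto (fun n => ((1 + -y / c n) ^ c n) ^ ((β n - 1) / c n)) atTop
      (𝓝 (Real.exp (-y) ^ (1 : ℝ))) := by
    refine ((Real.tendsto_one_add_div_rpow_exp (-y)).comp hc).rpow ?_
      (Or.inl (Real.exp_pos _).ne')
    have h2 : Tendsto (fun n => (c n / β n)⁻¹ - (c n)⁻¹) atTop (𝓝 (1⁻¹ - 0)) :=
      (hβc.inv₀ one_ne_zero).sub (tendsto_inv_atTop_zero.comp hc)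
    rw [inv_one, sub_zero] at h2
    refine h2.congr' ?_
    filter_upwards [hβ.eventually_gt_atTop 0, hc.eventually_gt_atTop 0] with n hn hcn
    field_simp
  rw [Real.rpow_one] at h1
  refine h1.congr' ?_
  have h3 : Tendsto (fun n => (c n)⁻¹ * y) atTop (𝓝 (0 * y)) :=
    (tendsto_inv_atTop_zero.comp hc).mul_const y
  rw [zero_mul] at h3
  filter_upwards [hc.eventually_gt_atTop 0, h3.eventually_lt_const one_pos] with n hcn hn
  have h4 : 1 + -y / c n = 1 - (c n)⁻¹ * y := by field_simp; ring
  rw [h4, ← Real.rpow_mul (sub_pos.2 hn).le]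
  congr 1
  field_simp

/-- The densities of rescaled beta distributions converge to the density of a gamma distribution. -/
theorem tendsto_betaPDFReal_div {α : ℝ} (hα : 0 < α) (hα1 : α < 1) {β c : ℕ → ℝ}
    (hβ : Tendsto β atTop atTop) (hc : Tendsto c atTop atTop)
    (hβc : Tendsto (fun n => c n / β n) atTop (𝓝 1)) {y : ℝ} (hy : y ≠ 0) :
    Tendsto (fun n => betaPDFReal α (β n) ((c n)⁻¹ * y) / c n) atTop
      (𝓝 (gammaPDFReal α 1 y)) := by
  rcases hy.lt_or_gt with hy | hy
  · rw [gammaPDFReal, if_neg (not_le.2 hy)]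
    refine tendsto_const_nhds.congr' ?_
    filter_upwards [hc.eventually_gt_atTop 0] with n hn
    have : (c n)⁻¹ * y < 0 := mul_neg_of_pos_of_neg (inv_pos.2 hn) hy
    rw [betaPDFReal, if_neg fun h => h.1.not_gt this, zero_div]
  · have hG := Real.Gamma_pos_of_pos hα
    have h1 : Tendsto (fun n => Real.Gamma (β n + α) / (Real.Gamma (β n) * β n ^ α) /
        (c n / β n) ^ α / Real.Gamma α * y ^ (α - 1) * (1 - (c n)⁻¹ * y) ^ (β n - 1)) atTop
        (𝓝 (1 / 1 ^ α / Real.Gamma α * y ^ (α - 1) * Real.exp (-y))) :=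
      (((((tendsto_Gamma_add_div hα hα1).comp hβ).div (hβc.rpow_const (Or.inl one_ne_zero))
        (by simp)).div_const _).mul_const _).mul (tendsto_one_sub_div_rpow hβ hc hβc y)
    have h2 : gammaPDFReal α 1 y = 1 / 1 ^ α / Real.Gamma α * y ^ (α - 1) * Real.exp (-y) := by
      rw [gammaPDFReal, if_pos hy.le]
      simp
    rw [h2]
    refine h1.congr' ?_
    have h3 : Tendsto (fun n => (c n)⁻¹ * y) atTop (𝓝 (0 * y)) :=
      (tendsto_inv_atTop_zero.comp hc).mul_const y
    rw [zero_mul] at h3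
    filter_upwards [hβ.eventually_gt_atTop 0, hc.eventually_gt_atTop 0,
      h3.eventually_lt_const one_pos] with n hβn hcn hn
    have hpos : 0 < (c n)⁻¹ * y := by positivity
    have hGβ := Real.Gamma_pos_of_pos hβn
    have hGαβ := Real.Gamma_pos_of_pos (add_pos hβn hα)
    rw [betaPDFReal, if_pos ⟨hpos, hn⟩, beta, add_comm α, Real.div_rpow hcn.le hβn.le,
      Real.mul_rpow (inv_pos.2 hcn).le hy.le, Real.inv_rpow hcn.le, Real.rpow_sub_one hcn.ne']
    have h4 : 0 < c n ^ α := by positivity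
    have h5 : 0 < β n ^ α := by positivity
    field_simp

/-- Rescaled beta distributions converge weakly to a gamma distribution. -/
theorem tendsto_integral_betaMeasure {α : ℝ} (hα : 0 < α) (hα1 : α < 1) {β c : ℕ → ℝ}
    (hβ : Tendsto β atTop atTop) (hc : Tendsto c atTop atTop)
    (hβc : Tendsto (fun n => c n / β n) atTop (𝓝 1)) (hβ0 : ∀ n, 0 < β n) (hc0 : ∀ n, 0 < c n)
    (f : BoundedContinuousFunction ℝ ℝ) :
    Tendsto (fun n => ∫ x, f (c n * x) ∂betaMeasure α (β n)) atTop
      (𝓝 (∫ x, f x ∂gammaMeasure α 1)) := by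
  have hγ : IsProbabilityMeasure (gammaMeasure α 1) := isProbabilityMeasure_gammaMeasure hα one_pos
  have hp : ∀ n, IsProbabilityMeasure ((betaMeasure α (β n)).map fun x => c n * x) := fun n =>
    have := isProbabilityMeasureBeta hα (hβ0 n)
    Measure.isProbabilityMeasure_map (by fun_prop)
  have h : Tendsto (β := ProbabilityMeasure ℝ) (fun n => ⟨_, hp n⟩) atTop
      (𝓝 ⟨gammaMeasure α 1, hγ⟩) := by
    refine tendsto_of_forall_isOpen_le_liminf' fun G hG => ?_
    simp only [ProbabilityMeasure.coe_mk, map_mul_betaMeasure (hc0 _)]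
    refine withDensity_apply_le_liminf (fun n => ?_) ?_ hG.measurableSet
    · have := (measurable_betaPDFReal α (β n)).comp (measurable_const_mul (c n)⁻¹)
      exact (this.div_const _).ennreal_ofReal
    · have h0 : ∀ᵐ x : ℝ, x ≠ 0 := by simp [ae_iff]
      filter_upwards [h0] with y hy
      exact ENNReal.tendsto_ofReal (tendsto_betaPDFReal_div hα hα1 hβ hc hβc hy)
  have h2 := ProbabilityMeasure.tendsto_iff_forall_integral_tendsto.1 h f
  refine h2.congr fun n => ?_
  exact integral_map (by fun_prop) f.continuous.aestronglyMeasurable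

/-! ### The number of descendants as a mixture of binomial distributions -/

theorem integral_numDescendants {k : ℕ} (hk : 1 ≤ k) (j N : ℕ) (f : ℕ → ℝ) :
    ∫ T, f (T.numDescendants (j + 1)) ∂randomKTree k (j + 1 + N) =
      ∑ i ∈ Finset.range (N + 1),
        betaBinomial (k / (k + 1)) (j + 2 / (k + 1)) N i * f (i + 1) := by
  set μ := randomKTree k (j + 1 + N)
  have hX : Measurable (fun T : OrderedIncreasingKTree k (j + 1 + N) => T.numDescendants (j + 1)) :=
    fun _ _ => trivial
  have hreal : ∀ m, (μ.map fun T => T.numDescendants (j + 1)).real {m} =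
      μ.real {T | T.numDescendants (j + 1) = m} := by
    intro m
    rw [measureReal_def, Measure.map_apply hX (measurableSet_singleton m)]
    rfl
  have hint : Integrable f (μ.map fun T => T.numDescendants (j + 1)) := by
    rw [integrable_map_measure (by fun_prop) hX.aemeasurable]
    exact Integrable.of_finite
  rw [← integral_map hX.aemeasurable (by fun_prop), integral_countable hint,
    tsum_eq_sum (s := Finset.range (N + 2)), Finset.sum_range_succ']
  · rw [hreal 0, randomKTree_real_numDescendants_eq_zero (k := k) (n := j + 1 + N) ⟨j, by omega⟩]
    simp only [hreal, zero_smul, add_zero]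
    refine Finset.sum_congr rfl fun i _ => ?_
    rw [randomKTree_real_numDescendants hk, smul_eq_mul]
  · intro m hm
    rw [Finset.mem_range, not_lt] at hm
    obtain ⟨i, rfl⟩ := Nat.exists_eq_add_of_le' (show 1 ≤ m by omega)
    rw [hreal, randomKTree_real_numDescendants hk, betaBinomial,
      Nat.choose_eq_zero_of_lt (by omega)]
    simp

theorem eval_bernsteinPolynomial (N i : ℕ) (x : ℝ) :
    (bernsteinPolynomial ℝ N i).eval x = N.choose i * x ^ i * (1 - x) ^ (N - i) := by
  simp [bernsteinPolynomial]

/-- The beta-binomial distribution is a mixture of binomial distributions. -/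
theorem integral_bernsteinPolynomial {α β : ℝ} (hα : 0 < α) (hβ : 0 < β) {N i : ℕ} (h : i ≤ N) :
    ∫ x, (bernsteinPolynomial ℝ N i).eval x ∂betaMeasure α β = betaBinomial α β N i := by
  simp only [eval_bernsteinPolynomial, mul_assoc]
  rw [integral_const_mul, integral_pow_mul_betaMeasure hα hβ, betaBinomial,
    Nat.add_sub_of_le h]
  ring

theorem sum_betaBinomial_mul {α β : ℝ} (hα : 0 < α) (hβ : 0 < β) (N : ℕ) (f : ℕ → ℝ) :
    ∑ i ∈ Finset.range (N + 1), betaBinomial α β N i * f i =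
      ∫ x, ∑ i ∈ Finset.range (N + 1), (bernsteinPolynomial ℝ N i).eval x * f i
        ∂betaMeasure α β := by
  rw [integral_finsetSum _ fun i _ => integrable_betaMeasure hα hβ (by fun_prop)]
  refine Finset.sum_congr rfl fun i hi => ?_
  rw [integral_mul_const, integral_bernsteinPolynomial hα hβ (Finset.mem_range_succ_iff.1 hi)]

theorem bernsteinPolynomial_eval_nonneg (N i : ℕ) {x : ℝ} (h0 : 0 ≤ x) (h1 : x ≤ 1) :
    0 ≤ (bernsteinPolynomial ℝ N i).eval x := by
  have := sub_nonneg.2 h1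
  rw [eval_bernsteinPolynomial]
  positivity

theorem sum_bernsteinPolynomial_eval (N : ℕ) (x : ℝ) :
    ∑ i ∈ Finset.range (N + 1), (bernsteinPolynomial ℝ N i).eval x = 1 := by
  rw [← Polynomial.eval_finsetSum, bernsteinPolynomial.sum, Polynomial.eval_one]

/-- The mean absolute deviation of a binomial distribution, bounded by its variance. -/
theorem sum_bernsteinPolynomial_abs_le (N : ℕ) {x δ : ℝ} (h0 : 0 ≤ x) (h1 : x ≤ 1) (hδ : 0 < δ) :
    ∑ i ∈ Finset.range (N + 1), (bernsteinPolynomial ℝ N i).eval x * |(i : ℝ) - N * x| ≤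
      δ * (N * x) + 1 / δ := by
  have hvar := congrArg (Polynomial.eval x) (bernsteinPolynomial.variance ℝ N)
  rw [Polynomial.eval_finsetSum] at hvar
  simp only [Polynomial.eval_mul, Polynomial.eval_pow, Polynomial.eval_sub,
    Polynomial.eval_X, Polynomial.eval_natCast, Polynomial.eval_one, nsmul_eq_mul] at hvar
  have hle : ∀ i : ℕ, |(i : ℝ) - N * x| ≤ δ * (N * x - i) ^ 2 + 1 / δ := by
    intro i
    -- `2 t ≤ δ t ^ 2 + 1 / δ`, by completing the square
    have hsq : (N * x - i) ^ 2 = |(i : ℝ) - N * x| ^ 2 := by rw [sq_abs]; ring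
    rw [hsq]
    set t := |(i : ℝ) - N * x|
    have h2 : 0 ≤ (δ * t - 1) ^ 2 / δ := by positivity
    have h3 : (δ * t - 1) ^ 2 / δ = δ * t ^ 2 + 1 / δ - 2 * t := by field_simp; ring
    have h4 : 0 ≤ t := abs_nonneg _
    linarith
  calc ∑ i ∈ Finset.range (N + 1), (bernsteinPolynomial ℝ N i).eval x * |(i : ℝ) - N * x|
      ≤ ∑ i ∈ Finset.range (N + 1), (bernsteinPolynomial ℝ N i).eval x *
          (δ * (N * x - i) ^ 2 + 1 / δ) :=
        Finset.sum_le_sum fun i _ => mul_le_mul_of_nonneg_left (hle i)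
          (bernsteinPolynomial_eval_nonneg N i h0 h1)
    _ = δ * ∑ i ∈ Finset.range (N + 1), (N * x - i) ^ 2 * (bernsteinPolynomial ℝ N i).eval x +
          1 / δ * ∑ i ∈ Finset.range (N + 1), (bernsteinPolynomial ℝ N i).eval x := by
        rw [Finset.mul_sum, Finset.mul_sum, ← Finset.sum_add_distrib]
        exact Finset.sum_congr rfl fun i _ => by ring
    _ ≤ _ := by
        rw [hvar, sum_bernsteinPolynomial_eval, mul_one]
        have hN : 0 ≤ N * x * x := by positivity
        have h : N * x * (1 - x) ≤ N * x := by linarith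
        gcongr

/-- The law of a multiple of `X / n` is close to that of the same multiple of the mixing beta
variable. -/
theorem abs_integral_numDescendants_sub_le {k : ℕ} (hk : 1 ≤ k) {j n : ℕ} (hj : 1 ≤ j)
    (hjn : j ≤ n) {c : ℝ} (hc : 0 ≤ c) {f : ℝ → ℝ} {L : NNReal} (hf : LipschitzWith L f) :
    |∫ T, f (c * (T.numDescendants j / n)) ∂randomKTree k n -
      ∫ x, f (c * x) ∂betaMeasure (k / (k + 1)) (j - 1 + 2 / (k + 1))| ≤
      2 * L * (c / √(j * n) + c / n) := by
  obtain ⟨l, rfl⟩ := Nat.exists_eq_add_of_le' hj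
  obtain ⟨N, rfl⟩ := Nat.exists_eq_add_of_le hjn
  have hk' : (0 : ℝ) < k := by exact_mod_cast hk
  set α : ℝ := k / (k + 1) with hα_def
  set β : ℝ := l + 2 / (k + 1) with hβ_def
  have hα : 0 < α := by positivity
  have hβ : 0 < β := by positivity
  have hβ' : ((l + 1 : ℕ) : ℝ) - 1 + 2 / (k + 1) = β := by push_cast; ring
  rw [hβ']
  have := isProbabilityMeasureBeta hα hβ
  set j : ℝ := ((l + 1 : ℕ) : ℝ) with hj_def
  have hj0 : 0 < j := by positivity
  set n : ℝ := ((l + 1 + N : ℕ) : ℝ) with hn_def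
  have hn0 : 0 < n := by positivity
  have hnN : n = j + N := by rw [hn_def, hj_def]; push_cast; ring
  -- this choice balances the two terms of `sum_bernsteinPolynomial_abs_le`, since the mean of the
  -- beta distribution is of order `1 / j`
  set δ : ℝ := √(j / n) with hδ_def
  have hδ : 0 < δ := by positivity
  have hfc : Continuous fun x => f (c * x) := hf.continuous.comp (by fun_prop)
  rw [integral_numDescendants hk l N fun m => f (c * (m / n)), ← hα_def, ← hβ_def,
    sum_betaBinomial_mul hα hβ N fun i => f (c * ((i + 1 : ℕ) / n)),
    ← integral_sub (integrable_betaMeasure hα hβ (by fun_prop))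
      (integrable_betaMeasure hα hβ hfc)]
  have hpt : ∀ x ∈ Set.Ioo (0 : ℝ) 1,
      ‖∑ i ∈ Finset.range (N + 1), (bernsteinPolynomial ℝ N i).eval x *
        f (c * ((i + 1 : ℕ) / n)) - f (c * x)‖ ≤
      L * (c / n) * (δ * n * x + 1 / δ + 1 + j * x) := by
    intro x hx
    have hsum : ∑ i ∈ Finset.range (N + 1), (bernsteinPolynomial ℝ N i).eval x *
        f (c * ((i + 1 : ℕ) / n)) - f (c * x) =
        ∑ i ∈ Finset.range (N + 1), (bernsteinPolynomial ℝ N i).eval x *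
          (f (c * ((i + 1 : ℕ) / n)) - f (c * x)) := by
      simp only [mul_sub, Finset.sum_sub_distrib, ← Finset.sum_mul,
        sum_bernsteinPolynomial_eval, one_mul]
    -- as `n = j + N`, the deviation of `i + 1` from `n x` is that of `i` from the binomial mean
    -- `N x`, up to `1 - j x`
    have hterm : ∀ i : ℕ, ‖f (c * ((i + 1 : ℕ) / n)) - f (c * x)‖ ≤
        L * (c / n) * (|(i : ℝ) - N * x| + (1 + j * x)) := by
      intro i
      have h1 := hf.dist_le_mul (c * ((i + 1 : ℕ) / n)) (c * x)
      rw [dist_eq_norm, Real.dist_eq] at h1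
      refine h1.trans ?_
      have h2 : c * (((i + 1 : ℕ) : ℝ) / n) - c * x = c / n * (i - N * x + (1 - j * x)) := by
        rw [hnN]
        have : j + N ≠ 0 := by positivity
        push_cast
        field_simp
        ring
      rw [h2, abs_mul, abs_of_nonneg (by positivity : 0 ≤ c / n), ← mul_assoc]
      refine mul_le_mul_of_nonneg_left ?_ (by positivity)
      refine (abs_add_le _ _).trans (add_le_add le_rfl ?_)
      have : 0 ≤ j * x := mul_nonneg hj0.le hx.1.le
      rw [abs_le]
      constructor <;> linarith
    rw [hsum]
    calc _ ≤ ∑ i ∈ Finset.range (N + 1), (bernsteinPolynomial ℝ N i).eval x *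
          (L * (c / n) * (|(i : ℝ) - N * x| + (1 + j * x))) := by
          refine (norm_sum_le _ _).trans (Finset.sum_le_sum fun i _ => ?_)
          have h0 := bernsteinPolynomial_eval_nonneg N i hx.1.le hx.2.le
          rw [norm_mul, Real.norm_of_nonneg h0]
          exact mul_le_mul_of_nonneg_left (hterm i) h0
      _ = L * (c / n) * (∑ i ∈ Finset.range (N + 1),
            (bernsteinPolynomial ℝ N i).eval x * |(i : ℝ) - N * x| +
            (1 + j * x) * ∑ i ∈ Finset.range (N + 1), (bernsteinPolynomial ℝ N i).eval x) := by
          rw [Finset.mul_sum (s := Finset.range (N + 1)) (a := 1 + j * x),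
            ← Finset.sum_add_distrib, Finset.mul_sum]
          exact Finset.sum_congr rfl fun i _ => by ring
      _ ≤ _ := by
          rw [sum_bernsteinPolynomial_eval, mul_one]
          have h1 := sum_bernsteinPolynomial_abs_le N hx.1.le hx.2.le hδ
          have h2 : δ * (N * x) ≤ δ * n * x := by
            rw [mul_assoc]
            have := hx.1.le
            have : (N : ℝ) ≤ n := by rw [hnN]; linarith
            gcongr
          have h3 : (0 : ℝ) ≤ L * (c / n) := by positivity
          refine mul_le_mul_of_nonneg_left ?_ h3
          linarith
  have hmean : ∫ x, x ∂betaMeasure α β ≤ 1 / j := by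
    have h := integral_pow_betaMeasure hα hβ 1
    simp only [pow_one, ascPochhammer_one, Polynomial.eval_X] at h
    rw [h]
    have h1 : α + β = j + 1 / (k + 1) := by
      rw [hα_def, hβ_def, hj_def]; push_cast; field_simp; ring
    have h2 : α ≤ 1 := by rw [hα_def, div_le_one (by positivity)]; linarith
    have h3 : j ≤ α + β := by
      have : (0 : ℝ) < 1 / (k + 1) := by positivity
      linarith
    gcongr
  have hid : Integrable (fun x : ℝ => x) (betaMeasure α β) :=
    integrable_betaMeasure hα hβ continuous_id
  calc _ ≤ ∫ x, L * (c / n) * (δ * n * x + 1 / δ + 1 + j * x) ∂betaMeasure α β :=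
        norm_integral_le_of_norm_le (integrable_betaMeasure hα hβ (by fun_prop))
          ((ae_mem_Ioo_betaMeasure α β).mono hpt)
    _ = L * (c / n) * ((δ * n + j) * ∫ x, x ∂betaMeasure α β + (1 / δ + 1)) := by
        rw [integral_const_mul]
        congr 1
        have h1 : ∀ x : ℝ, δ * n * x + 1 / δ + 1 + j * x = (δ * n + j) * x + (1 / δ + 1) :=
          fun x => by ring
        rw [integral_congr_ae (ae_of_all _ h1), integral_add (hid.const_mul _)
          (integrable_const _), integral_const_mul]
        simp
    _ ≤ L * (c / n) * ((δ * n + j) * (1 / j) + (1 / δ + 1)) := by gcongr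
    _ = _ := by
        have hδ2 : δ * δ = j / n := Real.mul_self_sqrt (by positivity)
        have h1 : √(j * n) = δ * n := by
          rw [show j * n = j / n * n ^ 2 by field_simp, Real.sqrt_mul (by positivity),
            Real.sqrt_sq hn0.le]
        have h2 : (δ * n + j) * (1 / j) = 1 / δ + 1 := by
          have : j = δ * δ * n := by rw [hδ2]; field_simp
          rw [this]
          field_simp
        rw [h1, h2]
        field_simp
        ring

/-! ### The negative binomial distribution as a limit of beta-binomial distributions -/

/-- The mass at `0` in terms of the quotients whose asymptotics are known from
`tendsto_Gamma_add_div`. -/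
theorem betaBinomial_zero_eq_Gamma {α β : ℝ} (hα : 0 < α) (hβ : 0 < β) (N : ℕ) :
    betaBinomial α β N 0 = Real.Gamma (β + α) / (Real.Gamma β * β ^ α) /
      (Real.Gamma (β + N + α) / (Real.Gamma (β + N) * (β + N) ^ α)) * (β / (β + N)) ^ α := by
  have hβN : 0 < β + N := by positivity
  rw [show β + N + α = α + β + N by ring, Gamma_add_natCast hβ, Gamma_add_natCast (add_pos hα hβ),
    add_comm β α, Real.div_rpow hβ.le hβN.le, betaBinomial]
  have h1 := ascPochhammer_eval_pos (add_pos hα hβ) N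
  have h2 := ascPochhammer_eval_pos hβ N
  have h3 := Real.Gamma_pos_of_pos (add_pos hα hβ)
  have h4 := Real.Gamma_pos_of_pos hβ
  have h5 : 0 < β ^ α := by positivity
  have h6 : 0 < (β + N) ^ α := by positivity
  simp only [Nat.choose_zero_right, Nat.cast_one, ascPochhammer_zero, Polynomial.eval_one,
    mul_one, one_mul, Nat.sub_zero]
  field_simp

theorem tendsto_betaBinomial_zero {α : ℝ} (hα : 0 < α) (hα1 : α < 1) {β : ℕ → ℝ} {N : ℕ → ℕ}
    (hβ : Tendsto β atTop atTop) {ρ : ℝ} (hρ : 0 < ρ)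
    (h : Tendsto (fun n => β n / (β n + N n)) atTop (𝓝 ρ)) :
    Tendsto (fun n => betaBinomial α (β n) (N n) 0) atTop (𝓝 (ρ ^ α)) := by
  have hβN : Tendsto (fun n => β n + N n) atTop atTop :=
    tendsto_atTop_mono (fun n => le_add_of_nonneg_right (Nat.cast_nonneg _)) hβ
  have h1 := (((tendsto_Gamma_add_div hα hα1).comp hβ).div
    ((tendsto_Gamma_add_div hα hα1).comp hβN) one_ne_zero).mul
    (h.rpow_const (p := α) (Or.inl hρ.ne'))
  rw [div_one, one_mul] at h1
  refine h1.congr' ?_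
  filter_upwards [hβ.eventually_gt_atTop 0] with n hn
  exact (betaBinomial_zero_eq_Gamma hα hn _).symm

/-- The quotient of consecutive masses, which reduces their limits to that of the mass at `0`. -/
theorem betaBinomial_succ {α β : ℝ} (hα : 0 < α) (hβ : 0 < β) {N i : ℕ} (h : i < N) :
    betaBinomial α β N (i + 1) =
      betaBinomial α β N i * ((N - i) / (β + N - (i + 1))) * ((α + i) / (i + 1)) := by
  obtain ⟨d, rfl⟩ := Nat.exists_eq_add_of_lt h
  have e1 : i + d + 1 - i = d + 1 := by omega
  have e2 : i + d + 1 - (i + 1) = d := by omega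
  have hD := (ascPochhammer_eval_pos (add_pos hα hβ) (i + d + 1)).ne'
  have hc : ((i + d + 1).choose (i + 1) : ℝ) * (i + 1) = (i + d + 1).choose i * (d + 1) := by
    have := Nat.choose_succ_right_eq (i + d + 1) i
    rw [e1] at this
    exact_mod_cast this
  have hd : β + ((i + d + 1 : ℕ) : ℝ) - (i + 1) = β + d := by push_cast; ring
  have hd' : ((i + d + 1 : ℕ) : ℝ) - i = d + 1 := by push_cast; ring
  have hd0 : β + d ≠ 0 := by positivity
  rw [hd, hd', betaBinomial, betaBinomial, e1, e2, ascPochhammer_succ_eval (S := ℝ) i,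
    ascPochhammer_succ_eval (S := ℝ) d]
  field_simp
  linear_combination (ascPochhammer ℝ i).eval α * (ascPochhammer ℝ d).eval β * hc

theorem tendsto_betaBinomial {α : ℝ} (hα : 0 < α) (hα1 : α < 1) {β : ℕ → ℝ} {N : ℕ → ℕ}
    (hβ : Tendsto β atTop atTop) {ρ : ℝ} (hρ : 0 < ρ) (hρ1 : ρ < 1)
    (h : Tendsto (fun n => β n / (β n + N n)) atTop (𝓝 ρ)) (i : ℕ) :
    Tendsto (fun n => betaBinomial α (β n) (N n) i) atTop
      (𝓝 ((ascPochhammer ℝ i).eval α / i.factorial * ρ ^ α * (1 - ρ) ^ i)) := by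
  have hβN : Tendsto (fun n => β n + N n) atTop atTop :=
    tendsto_atTop_mono (fun n => le_add_of_nonneg_right (Nat.cast_nonneg _)) hβ
  have hfrac : Tendsto (fun n => (N n : ℝ) / (β n + N n)) atTop (𝓝 (1 - ρ)) := by
    refine (tendsto_const_nhds.sub h).congr' ?_
    filter_upwards [hβN.eventually_gt_atTop 0] with n hn
    field_simp
    ring
  have hN : Tendsto (fun n => (N n : ℝ)) atTop atTop := by
    refine (hfrac.pos_mul_atTop (sub_pos.2 hρ1) hβN).congr' ?_
    filter_upwards [hβN.eventually_gt_atTop 0] with n hn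
    field_simp
  induction i with
  | zero => simpa using tendsto_betaBinomial_zero hα hα1 hβ hρ h
  | succ i ih =>
    have h1 : Tendsto (fun n => ((N n : ℝ) / (β n + N n) - i / (β n + N n)) /
        (1 - (i + 1) / (β n + N n))) atTop (𝓝 ((1 - ρ - 0) / (1 - 0))) :=
      (hfrac.sub (tendsto_const_nhds.div_atTop hβN)).div
        (tendsto_const_nhds.sub (tendsto_const_nhds.div_atTop hβN)) (by simp)
    have h2 := (ih.mul h1).mul_const ((α + i) / (i + 1))
    have h3 : (ascPochhammer ℝ (i + 1)).eval α / (i + 1).factorial * ρ ^ α * (1 - ρ) ^ (i + 1) =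
        (ascPochhammer ℝ i).eval α / i.factorial * ρ ^ α * (1 - ρ) ^ i *
          ((1 - ρ - 0) / (1 - 0)) * ((α + i) / (i + 1)) := by
      rw [ascPochhammer_succ_eval, Nat.factorial_succ]
      push_cast
      field_simp
      ring
    rw [h3]
    refine h2.congr' ?_
    filter_upwards [hβ.eventually_gt_atTop 0, hβN.eventually_gt_atTop (i + 1 : ℝ),
      hN.eventually_gt_atTop (i : ℝ)] with n hβn hn hNn
    rw [betaBinomial_succ hα hβn (by exact_mod_cast hNn)]
    have h4 : 0 < β n + N n := lt_trans (by positivity) hn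
    have h5 : β n + N n - (i + 1) ≠ 0 := (sub_pos.2 hn).ne'
    congr 2
    rw [← sub_div, one_sub_div h4.ne', div_div_div_cancel_right₀ h4.ne']

theorem gbinom_add_sub_one (x : ℝ) (m : ℕ) :
    gbinom (m + x - 1) m = (ascPochhammer ℝ m).eval x / m.factorial := by
  rw [add_comm, gbinom_eq_ascPochhammer]

theorem negBinMeasure_apply (r p : ℝ) (s : Set ℕ) :
    negBinMeasure r p s =
      ∑' m : ℕ, s.indicator
        (fun m : ℕ => ENNReal.ofReal (gbinom (m + r - 1) m * p ^ r * (1 - p) ^ m)) m := by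
  rw [negBinMeasure, Measure.sum_apply _ (MeasurableSet.of_discrete)]
  refine tsum_congr fun m => ?_
  rw [Measure.smul_apply, Measure.dirac_apply, smul_eq_mul]
  by_cases hm : m ∈ s <;> simp [hm]

theorem negBinMeasure_mass_nonneg {r p : ℝ} (hr : 0 < r) (hp : 0 < p) (hp1 : p < 1) (m : ℕ) :
    0 ≤ gbinom (m + r - 1) m * p ^ r * (1 - p) ^ m := by
  have := sub_pos.2 hp1
  have := ascPochhammer_eval_pos hr m
  rw [gbinom_add_sub_one]
  positivity

theorem negBinMeasure_real_singleton {r p : ℝ} (hr : 0 < r) (hp : 0 < p) (hp1 : p < 1) (m : ℕ) :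
    (negBinMeasure r p).real {m} = gbinom (m + r - 1) m * p ^ r * (1 - p) ^ m := by
  rw [measureReal_def, negBinMeasure_apply, tsum_eq_single m fun m' hm' => by simp [hm'],
    Set.indicator_of_mem (Set.mem_singleton m),
    ENNReal.toReal_ofReal (negBinMeasure_mass_nonneg hr hp hp1 m)]

/-- The masses add up to `1` by the binomial series of `(1 - x) ^ (-r)` at `x = 1 - p`. -/
theorem isProbabilityMeasure_negBinMeasure {r p : ℝ} (hr : 0 < r) (hp : 0 < p) (hp1 : p < 1) :
    IsProbabilityMeasure (negBinMeasure r p) := by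
  have hsum : HasSum (fun m : ℕ => gbinom (m + r - 1) m * p ^ r * (1 - p) ^ m) 1 := by
    have h1 : (1 - p) ∈ Metric.eball (0 : ℝ) 1 := by
      rw [← ENNReal.ofReal_one, Metric.eball_ofReal, mem_ball_zero_iff, Real.norm_eq_abs, abs_lt]
      constructor <;> linarith
    have h2 := ((Real.one_div_one_sub_rpow_hasFPowerSeriesOnBall_zero r).hasSum h1).mul_left (p ^ r)
    rw [zero_add, sub_sub_cancel, mul_one_div, div_self (Real.rpow_pos_of_pos hp r).ne'] at h2
    refine h2.congr_fun fun m => ?_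
    rw [gbinom, if_pos (Int.natCast_nonneg m), Int.toNat_natCast, add_comm (m : ℝ) r]
    simp
    ring
  refine ⟨?_⟩
  rw [negBinMeasure_apply]
  simp only [Set.indicator_univ]
  rw [← ENNReal.ofReal_tsum_of_nonneg (negBinMeasure_mass_nonneg hr hp hp1) hsum.summable,
    hsum.tsum_eq, ENNReal.ofReal_one]

/-! ### Limit theorems -/

theorem tendstoInDistribution_of_forall_lipschitz {Ω : ℕ → Type*} {m : ∀ n, MeasurableSpace (Ω n)}
    {μ : ∀ n, Measure (Ω n)} [∀ n, IsProbabilityMeasure (μ n)] {ν : Measure ℝ}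
    [IsProbabilityMeasure ν] {X : ∀ n, Ω n → ℝ} (hX : ∀ n, Measurable (X n))
    (h : ∀ f : BoundedContinuousFunction ℝ ℝ, (∃ L, LipschitzWith L f) →
      Tendsto (fun n => ∫ ω, f (X n ω) ∂μ n) atTop (𝓝 (∫ x, f x ∂ν))) :
    TendstoInDistribution X atTop (fun x : ℝ => x) μ ν where
  forall_aemeasurable n := (hX n).aemeasurable
  aemeasurable_limit := aemeasurable_id
  tendsto := by
    refine tendsto_iff_forall_lipschitz_integral_tendsto.2 fun f hb hL => ?_
    have hc : Continuous f := hL.choose_spec.continuous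
    simp only [ProbabilityMeasure.coe_mk]
    rw [integral_map (by fun_prop) hc.aestronglyMeasurable]
    refine (h ⟨⟨f, hc⟩, hb⟩ hL).congr fun n => ?_
    exact (integral_map (hX n).aemeasurable hc.aestronglyMeasurable).symm

theorem measurable_of_tree {k n : ℕ} (f : OrderedIncreasingKTree k n → ℝ) : Measurable f :=
  fun _ _ => trivial

section

variable {k : ℕ}

theorem tendstoInDistribution_beta (hk : 1 ≤ k) {j : ℕ} (hj : 1 ≤ j)
    [IsProbabilityMeasure (betaMeasure ((k : ℝ) / (k + 1)) ((j : ℝ) - 1 + 2 / (k + 1)))] :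
    TendstoInDistribution
      (fun (n : ℕ) (T : OrderedIncreasingKTree k n) => (T.numDescendants j : ℝ) / (n : ℝ))
      atTop (fun x : ℝ => x) (fun n => randomKTree k n)
      (betaMeasure ((k : ℝ) / (k + 1)) ((j : ℝ) - 1 + 2 / (k + 1))) := by
  refine tendstoInDistribution_of_forall_lipschitz (fun n => measurable_of_tree _) ?_
  rintro f ⟨L, hL⟩
  rw [tendsto_iff_norm_sub_tendsto_zero]
  have hbound : Tendsto (fun n : ℕ => 2 * (L : ℝ) * (1 / √(j * n) + 1 / n)) atTop
      (𝓝 (2 * L * (0 + 0))) := by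
    have hj0 : (0 : ℝ) < j := by exact_mod_cast hj
    refine tendsto_const_nhds.mul (Tendsto.add ?_ tendsto_one_div_atTop_nhds_zero_nat)
    exact tendsto_const_nhds.div_atTop (Real.tendsto_sqrt_atTop.comp
      (tendsto_natCast_atTop_atTop.const_mul_atTop hj0))
  rw [add_zero, mul_zero] at hbound
  refine squeeze_zero' (Eventually.of_forall fun n => norm_nonneg _) ?_ hbound
  filter_upwards [eventually_ge_atTop j] with n hn
  simpa using abs_integral_numDescendants_sub_le hk hj hn zero_le_one hL

theorem beta_params_pos (hk : 1 ≤ k) {j : ℕ} (hj : 1 ≤ j) :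
    0 < (k : ℝ) / (k + 1) ∧ 0 < (j : ℝ) - 1 + 2 / (k + 1) := by
  have h1 : (1 : ℝ) ≤ k := by exact_mod_cast hk
  have h2 : (1 : ℝ) ≤ j := by exact_mod_cast hj
  have h3 : (0 : ℝ) < 2 / (k + 1) := by positivity
  exact ⟨by positivity, by linarith⟩

theorem tendstoInDistribution_gamma (hk : 1 ≤ k) {j : ℕ → ℕ} (hj : Tendsto j atTop atTop)
    (hjn : (fun n => (j n : ℝ)) =o[atTop] (fun n : ℕ => (n : ℝ)))
    [IsProbabilityMeasure (gammaMeasure ((k : ℝ) / (k + 1)) 1)] :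
    TendstoInDistribution
      (fun (n : ℕ) (T : OrderedIncreasingKTree k n) =>
        (j n : ℝ) / (n : ℝ) * (T.numDescendants (j n) : ℝ))
      atTop (fun x : ℝ => x) (fun n => randomKTree k n)
      (gammaMeasure ((k : ℝ) / (k + 1)) 1) := by
  have hk' : (0 : ℝ) < k := by exact_mod_cast hk
  have hα : (0 : ℝ) < k / (k + 1) := by positivity
  have hα1 : (k : ℝ) / (k + 1) < 1 := by rw [div_lt_one (by positivity)]; linarith
  refine tendstoInDistribution_of_forall_lipschitz (fun n => measurable_of_tree _) ?_
  rintro f ⟨L, hL⟩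
  have hfrac := hjn.tendsto_div_nhds_zero
  have hle : ∀ᶠ n in atTop, j n ≤ n := by
    filter_upwards [hfrac.eventually_lt_const one_pos, eventually_gt_atTop 0] with n hn hn0
    rw [div_lt_one (by exact_mod_cast hn0)] at hn
    exact_mod_cast hn.le
  -- the weak limit theorem for beta distributions needs positive parameters for every `n`
  have hmax : ∀ᶠ n in atTop, max (j n) 1 = j n :=
    (hj.eventually_ge_atTop 1).mono fun n hn => max_eq_left hn
  have hjR : Tendsto (fun n => ((max (j n) 1 : ℕ) : ℝ)) atTop atTop :=
    tendsto_natCast_atTop_atTop.comp (tendsto_atTop_mono (fun n => le_max_left _ _) hj)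
  have hβ : Tendsto (fun n => ((max (j n) 1 : ℕ) : ℝ) - 1 + 2 / (k + 1)) atTop atTop :=
    tendsto_atTop_add_const_right _ _ (tendsto_atTop_add_const_right _ _ hjR)
  have hquot : Tendsto (fun n => ((max (j n) 1 : ℕ) : ℝ) /
      (((max (j n) 1 : ℕ) : ℝ) - 1 + 2 / (k + 1))) atTop (𝓝 1) := by
    have h1 : Tendsto (fun n => 1 - (-1 + 2 / ((k : ℝ) + 1)) /
        (((max (j n) 1 : ℕ) : ℝ) - 1 + 2 / (k + 1))) atTop (𝓝 (1 - 0)) :=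
      tendsto_const_nhds.sub (tendsto_const_nhds.div_atTop hβ)
    rw [sub_zero] at h1
    refine h1.congr' ?_
    filter_upwards [hβ.eventually_gt_atTop 0] with n hn
    rw [eq_div_iff hn.ne', sub_mul, div_mul_cancel₀ _ hn.ne']
    ring
  have hlim := tendsto_integral_betaMeasure hα hα1 hβ hjR hquot
    (fun n => (beta_params_pos hk (le_max_right _ _)).2)
    (fun n => by positivity) f
  have hdiff : Tendsto (fun n => ∫ T : OrderedIncreasingKTree k n,
      f ((j n : ℝ) / n * T.numDescendants (j n)) ∂randomKTree k n -
      ∫ x, f (((max (j n) 1 : ℕ) : ℝ) * x) ∂betaMeasure ((k : ℝ) / (k + 1))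
        (((max (j n) 1 : ℕ) : ℝ) - 1 + 2 / (k + 1))) atTop (𝓝 0) := by
    have hbound : Tendsto (fun n : ℕ => 2 * (L : ℝ) * (√((j n : ℝ) / n) + (j n : ℝ) / n)) atTop
        (𝓝 (2 * L * (√0 + 0))) :=
      tendsto_const_nhds.mul (hfrac.sqrt.add hfrac)
    rw [Real.sqrt_zero, add_zero, mul_zero] at hbound
    refine squeeze_zero_norm' ?_ hbound
    filter_upwards [hle, hmax, hj.eventually_ge_atTop 1] with n hn hm h1
    have hj0 : (0 : ℝ) < j n := by exact_mod_cast h1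
    have hn0 : (0 : ℝ) < n := hj0.trans_le (by exact_mod_cast hn)
    have h2 := abs_integral_numDescendants_sub_le hk h1 hn hj0.le hL
    have h3 : (j n : ℝ) / √(j n * n) = √((j n : ℝ) / n) := by
      rw [Real.sqrt_mul hj0.le, Real.sqrt_div hj0.le, ← div_div, Real.div_sqrt]
    rw [h3] at h2
    rw [hm, Real.norm_eq_abs]
    refine le_trans (le_of_eq ?_) h2
    congr 2
    refine integral_congr_ae (ae_of_all _ fun T => ?_)
    exact congrArg f (by ring)
  have := hdiff.add hlim
  rw [zero_add] at this
  exact this.congr fun n => sub_add_cancel _ _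

theorem randomKTree_real_numDescendants_of_le (hk : 1 ≤ k) {j n : ℕ} (hj : 1 ≤ j) (hjn : j ≤ n)
    (i : ℕ) : (randomKTree k n).real {T | T.numDescendants j = i + 1} =
      betaBinomial (k / (k + 1)) (j - 1 + 2 / (k + 1)) (n - j) i := by
  obtain ⟨l, rfl⟩ := Nat.exists_eq_add_of_le' hj
  obtain ⟨N, rfl⟩ := Nat.exists_eq_add_of_le hjn
  rw [randomKTree_real_numDescendants hk, Nat.add_sub_cancel_left]
  push_cast
  rw [add_sub_cancel_right]

/-- The parameters of the beta-binomial distribution when `j` grows linearly in `n`. -/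
theorem tendsto_param {j : ℕ → ℕ} {ρ : ℝ} (hρ : 0 < ρ) (hle : ∀ᶠ n in atTop, j n ≤ n)
    (h : Tendsto (fun n => (j n : ℝ) / n) atTop (𝓝 ρ)) (b : ℝ) :
    Tendsto (fun n => (j n : ℝ) - 1 + b) atTop atTop ∧
      Tendsto (fun n => ((j n : ℝ) - 1 + b) / ((j n : ℝ) - 1 + b + (n - j n : ℕ))) atTop (𝓝 ρ) := by
  have hn : Tendsto (fun n : ℕ => (n : ℝ)) atTop atTop := tendsto_natCast_atTop_atTop
  constructor
  · have h1 : Tendsto (fun n => (j n : ℝ)) atTop atTop := by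
      refine (h.pos_mul_atTop hρ hn).congr' ?_
      filter_upwards [eventually_gt_atTop 0] with n hn0
      field_simp
    exact tendsto_atTop_add_const_right _ _ (tendsto_atTop_add_const_right _ _ h1)
  · have h1 : Tendsto (fun n : ℕ => ((j n : ℝ) / n + (b - 1) / n) / (1 + (b - 1) / n)) atTop
        (𝓝 ((ρ + 0) / (1 + 0))) :=
      (h.add (tendsto_const_nhds.div_atTop hn)).div
        (tendsto_const_nhds.add (tendsto_const_nhds.div_atTop hn)) (by simp)
    rw [add_zero, add_zero, div_one] at h1
    refine h1.congr' ?_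
    filter_upwards [hle, eventually_gt_atTop 0] with n hjn hn0
    have hn0' : (n : ℝ) ≠ 0 := by positivity
    rw [← add_div, one_add_div hn0', div_div_div_cancel_right₀ hn0', Nat.cast_sub hjn]
    congr 1 <;> ring

theorem tendsto_randomKTree_real_numDescendants (hk : 1 ≤ k) {j : ℕ → ℕ} {ρ : ℝ} (hρ : 0 < ρ)
    (hρ1 : ρ < 1) (h : Tendsto (fun n => (j n : ℝ) / n) atTop (𝓝 ρ)) (i : ℕ) :
    Tendsto (fun n => (randomKTree k n).real {T | T.numDescendants (j n) = i + 1}) atTop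
      (𝓝 (gbinom (i + (k : ℝ) / (k + 1) - 1) i * ρ ^ ((k : ℝ) / (k + 1)) * (1 - ρ) ^ i)) := by
  have hk' : (0 : ℝ) < k := by exact_mod_cast hk
  have hα : (0 : ℝ) < k / (k + 1) := by positivity
  have hα1 : (k : ℝ) / (k + 1) < 1 := by rw [div_lt_one (by positivity)]; linarith
  have hle : ∀ᶠ n in atTop, j n ≤ n := by
    filter_upwards [h.eventually_lt_const hρ1, eventually_gt_atTop 0] with n hn hn0
    rw [div_lt_one (by exact_mod_cast hn0)] at hn
    exact_mod_cast hn.le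
  have hpos : ∀ᶠ n in atTop, 1 ≤ j n := by
    filter_upwards [h.eventually_const_lt hρ] with n hn
    refine Nat.one_le_iff_ne_zero.2 fun h0 => ?_
    simp [h0] at hn
  obtain ⟨h1, h2⟩ := tendsto_param hρ hle h (2 / ((k : ℝ) + 1))
  rw [gbinom_add_sub_one]
  refine (tendsto_betaBinomial hα hα1 h1 hρ hρ1 h2 i).congr' ?_
  filter_upwards [hle, hpos] with n hn h0
  exact (randomKTree_real_numDescendants_of_le hk h0 hn i).symm

/-- Convergence of the point masses implies convergence in distribution, since by Fatou's lemma no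
mass of the limit is lost on an open set. -/
theorem tendstoInDistribution_negBin (hk : 1 ≤ k) {j : ℕ → ℕ} {ρ : ℝ} (hρ : 0 < ρ)
    (hρ1 : ρ < 1) (h : Tendsto (fun n => (j n : ℝ) / n) atTop (𝓝 ρ))
    [IsProbabilityMeasure (negBinMeasure ((k : ℝ) / (k + 1)) ρ)] :
    TendstoInDistribution
      (fun (n : ℕ) (T : OrderedIncreasingKTree k n) => (T.numDescendants (j n) : ℝ) - 1)
      atTop (fun m : ℕ => (m : ℝ)) (fun n => randomKTree k n)
      (negBinMeasure ((k : ℝ) / (k + 1)) ρ) where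
  forall_aemeasurable n := (measurable_of_tree _).aemeasurable
  aemeasurable_limit := (Measurable.of_discrete).aemeasurable
  tendsto := by
    refine tendsto_of_forall_isOpen_le_liminf' fun G hG => ?_
    simp only [ProbabilityMeasure.coe_mk]
    rw [Measure.map_apply Measurable.of_discrete hG.measurableSet, negBinMeasure_apply,
      ← lintegral_count]
    set S : Set ℕ := (fun m : ℕ => (m : ℝ)) ⁻¹' G
    have hlim : ∀ i, Tendsto (fun n => S.indicator
        (fun i => randomKTree k n {T | T.numDescendants (j n) = i + 1}) i) atTop
        (𝓝 (S.indicator (fun m : ℕ => ENNReal.ofReal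
          (gbinom (m + (k : ℝ) / (k + 1) - 1) m * ρ ^ ((k : ℝ) / (k + 1)) * (1 - ρ) ^ m)) i)) := by
      intro i
      by_cases hi : i ∈ S
      · simp only [Set.indicator_of_mem hi]
        refine (ENNReal.tendsto_ofReal
          (tendsto_randomKTree_real_numDescendants hk hρ hρ1 h i)).congr fun n => ?_
        exact ofReal_measureReal
      · simp only [Set.indicator_of_notMem hi]
        exact tendsto_const_nhds
    calc _ = ∫⁻ i, liminf (fun n => S.indicator
          (fun i => randomKTree k n {T | T.numDescendants (j n) = i + 1}) i) atTop
            ∂Measure.count := lintegral_congr fun i => (hlim i).liminf_eq.symm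
      _ ≤ liminf (fun n => ∫⁻ i, S.indicator
          (fun i => randomKTree k n {T | T.numDescendants (j n) = i + 1}) i
            ∂Measure.count) atTop := lintegral_liminf_le fun n => Measurable.of_discrete
      -- the value `X = 0`, possible only for `j n = 0` or `n < j n`, is left out of the sum
      _ ≤ _ := by
        refine liminf_le_liminf (Eventually.of_forall fun n => ?_)
        have hX : Measurable fun T : OrderedIncreasingKTree k n => T.numDescendants (j n) :=
          fun _ _ => trivial
        set ν := (randomKTree k n).map fun T => T.numDescendants (j n)
        have hν : ∀ s, ν s = randomKTree k n {T | T.numDescendants (j n) ∈ s} := fun s =>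
          Measure.map_apply hX MeasurableSet.of_discrete
        set R : Set ℕ := {m | (m : ℝ) - 1 ∈ G}
        rw [lintegral_count, Measure.map_apply (measurable_of_tree _) hG.measurableSet]
        have h1 : ν R = randomKTree k n ((fun T : OrderedIncreasingKTree k n =>
            (T.numDescendants (j n) : ℝ) - 1) ⁻¹' G) := hν R
        rw [← h1, ← Measure.tsum_indicator_apply_singleton ν R MeasurableSet.of_discrete]
        refine le_trans (le_of_eq (tsum_congr fun i => ?_))
          (ENNReal.tsum_comp_le_tsum_of_injective (add_left_injective 1) _)
        have h2 : i + 1 ∈ R ↔ i ∈ S := by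
          simp only [R, S, Set.mem_ofPred_eq, Set.mem_preimage]
          push_cast
          rw [add_sub_cancel_right]
        by_cases hi : i ∈ S
        · rw [Set.indicator_of_mem hi, Set.indicator_of_mem (h2.2 hi), hν]
          rfl
        · rw [Set.indicator_of_notMem hi, Set.indicator_of_notMem fun h => hi (h2.1 h)]

theorem tendsto_randomKTree_real_numDescendants_one (hk : 1 ≤ k) {j : ℕ → ℕ}
    (hle : ∀ᶠ n in atTop, j n ≤ n)
    (h : (fun n : ℕ => (n : ℝ) - (j n : ℝ)) =o[atTop] (fun n : ℕ => (n : ℝ))) :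
    Tendsto (fun n => (randomKTree k n).real {T | T.numDescendants (j n) = 1}) atTop (𝓝 1) := by
  have hk' : (0 : ℝ) < k := by exact_mod_cast hk
  have hα : (0 : ℝ) < k / (k + 1) := by positivity
  have hα1 : (k : ℝ) / (k + 1) < 1 := by rw [div_lt_one (by positivity)]; linarith
  have hfrac : Tendsto (fun n => (j n : ℝ) / n) atTop (𝓝 1) := by
    have h1 := h.tendsto_div_nhds_zero.const_sub 1
    rw [sub_zero] at h1
    refine h1.congr' ?_
    filter_upwards [eventually_gt_atTop 0] with n hn
    field_simp
    ring
  have hpos : ∀ᶠ n in atTop, 1 ≤ j n := by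
    filter_upwards [hfrac.eventually_const_lt one_pos] with n hn
    refine Nat.one_le_iff_ne_zero.2 fun h0 => ?_
    simp [h0] at hn
  obtain ⟨h1, h2⟩ := tendsto_param one_pos hle hfrac (2 / ((k : ℝ) + 1))
  have h3 := tendsto_betaBinomial_zero hα hα1 h1 one_pos h2
  rw [Real.one_rpow] at h3
  refine h3.congr' ?_
  filter_upwards [hle, hpos] with n hn h0
  exact (randomKTree_real_numDescendants_of_le hk h0 hn 0).symm

end

theorem theorem5 (k : ℕ) (hk : 1 ≤ k) :
    -- the exact distribution
    (∀ n j m : ℕ, 1 ≤ j → j ≤ n → 1 ≤ m →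
      (randomKTree k n).real {T | T.numDescendants j = m} =
        gbinom ((m : ℝ) - 1 - 1 / ((k : ℝ) + 1)) ((m : ℤ) - 1) *
          gbinom ((n : ℝ) - m - 1 + 2 / ((k : ℝ) + 1)) ((n : ℤ) - m - j + 1) /
            gbinom ((n : ℝ) - (k : ℝ) / ((k : ℝ) + 1)) ((n : ℤ) - j)) ∧
    -- `j` fixed
    (∀ j : ℕ, 1 ≤ j →
      (∃ _ : IsProbabilityMeasure
            (betaMeasure ((k : ℝ) / ((k : ℝ) + 1)) ((j : ℝ) - 1 + 2 / ((k : ℝ) + 1))),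
        TendstoInDistribution
          (fun (n : ℕ) (T : OrderedIncreasingKTree k n) => (T.numDescendants j : ℝ) / (n : ℝ))
          atTop (fun x : ℝ => x) (fun n => randomKTree k n)
          (betaMeasure ((k : ℝ) / ((k : ℝ) + 1)) ((j : ℝ) - 1 + 2 / ((k : ℝ) + 1)))) ∧
      ∀ s : ℕ,
        Integrable (fun x : ℝ => x ^ s)
          (betaMeasure ((k : ℝ) / ((k : ℝ) + 1)) ((j : ℝ) - 1 + 2 / ((k : ℝ) + 1))) ∧
        ∫ x, x ^ s ∂(betaMeasure ((k : ℝ) / ((k : ℝ) + 1)) ((j : ℝ) - 1 + 2 / ((k : ℝ) + 1))) =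
          gbinom ((s : ℝ) - 1 / ((k : ℝ) + 1)) s /
            gbinom ((s : ℝ) + j - (k : ℝ) / ((k : ℝ) + 1)) s) ∧
    -- `j → ∞` with `j = o(n)`
    ((∀ j : ℕ → ℕ, Tendsto j atTop atTop →
        (fun n => (j n : ℝ)) =o[atTop] (fun n : ℕ => (n : ℝ)) →
        ∃ _ : IsProbabilityMeasure (gammaMeasure ((k : ℝ) / ((k : ℝ) + 1)) 1),
          TendstoInDistribution
            (fun (n : ℕ) (T : OrderedIncreasingKTree k n) =>
              (j n : ℝ) / (n : ℝ) * (T.numDescendants (j n) : ℝ))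
            atTop (fun x : ℝ => x) (fun n => randomKTree k n)
            (gammaMeasure ((k : ℝ) / ((k : ℝ) + 1)) 1)) ∧
      ∀ s : ℕ,
        Integrable (fun x : ℝ => x ^ s) (gammaMeasure ((k : ℝ) / ((k : ℝ) + 1)) 1) ∧
        ∫ x, x ^ s ∂(gammaMeasure ((k : ℝ) / ((k : ℝ) + 1)) 1) =
          (s.factorial : ℝ) * gbinom ((s : ℝ) - 1 / ((k : ℝ) + 1)) s) ∧
    -- `j ∼ ρ n` with `0 < ρ < 1`
    (∀ ρ : ℝ, 0 < ρ → ρ < 1 →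
      (∀ j : ℕ → ℕ,
        (fun n => (j n : ℝ)) ~[atTop] (fun n : ℕ => ρ * (n : ℝ)) →
        ∃ _ : IsProbabilityMeasure (negBinMeasure ((k : ℝ) / ((k : ℝ) + 1)) ρ),
          TendstoInDistribution
            (fun (n : ℕ) (T : OrderedIncreasingKTree k n) =>
              (T.numDescendants (j n) : ℝ) - 1)
            atTop (fun m : ℕ => (m : ℝ)) (fun n => randomKTree k n)
            (negBinMeasure ((k : ℝ) / ((k : ℝ) + 1)) ρ)) ∧
      ∀ m : ℕ,
        (negBinMeasure ((k : ℝ) / ((k : ℝ) + 1)) ρ).real {m} =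
          gbinom ((m : ℝ) - 1 / ((k : ℝ) + 1)) m *
            ρ ^ ((k : ℝ) / ((k : ℝ) + 1)) * (1 - ρ) ^ m) ∧
    -- `j ≤ n` with `n - j = o(n)`
    (∀ j : ℕ → ℕ, (∀ᶠ n in atTop, j n ≤ n) →
      (fun n : ℕ => (n : ℝ) - (j n : ℝ)) =o[atTop] (fun n : ℕ => (n : ℝ)) →
      Tendsto (fun n => (randomKTree k n).real {T | T.numDescendants (j n) = 1})
        atTop (𝓝 1)) := by
  have hk' : (0 : ℝ) < k := by exact_mod_cast hk
  have hα : (0 : ℝ) < k / (k + 1) := by positivity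
  have hα' : ∀ s : ℕ, (s : ℝ) - 1 / ((k : ℝ) + 1) = s + k / (k + 1) - 1 := by
    intro s
    field_simp
    ring
  refine ⟨fun n j m => randomKTree_real_numDescendants_eq_gbinom hk, fun j hj => ⟨?_, fun s => ?_⟩,
    ⟨fun j hj hjn => ?_, fun s => ?_⟩, fun ρ hρ hρ1 => ⟨fun j hj => ?_, fun m => ?_⟩,
    fun j => tendsto_randomKTree_real_numDescendants_one hk⟩
  · obtain ⟨h1, h2⟩ := beta_params_pos hk hj
    have := isProbabilityMeasureBeta h1 h2
    exact ⟨this, tendstoInDistribution_beta hk hj⟩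
  · obtain ⟨h1, h2⟩ := beta_params_pos hk hj
    refine ⟨integrable_betaMeasure h1 h2 (by fun_prop), ?_⟩
    have h3 : (s : ℝ) + j - k / (k + 1) =
        s + (k / (k + 1) + (j - 1 + 2 / (k + 1))) - 1 := by
      field_simp
      ring
    rw [integral_pow_betaMeasure h1 h2, hα', h3, gbinom_add_sub_one, gbinom_add_sub_one,
      div_div_div_cancel_right₀ (by positivity)]
  · have := isProbabilityMeasure_gammaMeasure hα one_pos
    exact ⟨this, tendstoInDistribution_gamma hk hj hjn⟩
  · obtain ⟨h1, h2⟩ := gammaMeasure_moment hα s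
    refine ⟨h1, ?_⟩
    rw [h2, hα', gbinom_add_sub_one, mul_div_cancel₀ _ (by positivity)]
  · have := isProbabilityMeasure_negBinMeasure hα hρ hρ1
    refine ⟨this, tendstoInDistribution_negBin hk hρ hρ1 ?_⟩
    have h1 : ∀ᶠ n : ℕ in atTop, ρ * (n : ℝ) ≠ 0 := by
      filter_upwards [eventually_gt_atTop 0] with n hn
      positivity
    have h2 := ((isEquivalent_iff_tendsto_one h1).1 hj).const_mul ρ
    rw [mul_one] at h2
    refine h2.congr' ?_
    filter_upwards [eventually_gt_atTop 0] with n hn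
    simp only [Pi.div_apply]
    field_simp
  · rw [negBinMeasure_real_singleton hα hρ hρ1, hα']
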